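/- Let $k\ge 3$ and let $\widetilde V\subset\mathbb C^k$ be an algebraic variety (the common zero set of a family of polynomials, not necessarily irreducible) of codimension $2$. Then there is a Short $\mathbb C^k$ $\Omega\subset\mathbb C^k$ with $\Omega\cap\widetilde V=\emptyset$. Here a Short $\mathbb C^k$ is a non-empty connected open set $\Omega\subset\mathbb C^k$ such that (a) $\Omega=\bigcup_{j}\Omega_j$ for open sets $\Omega_j\subset\Omega_{j+1}$, each biholomorphic to the Euclidean unit ball of $\mathbb C^k$; (b) the infinitesimal Kobayashi metric of $\Omega$ vanishes identically; (c) there is a plurisubharmonic function $\phi:\mathbb C^k\to\mathbb R$, bounded below and non-constant on $\Omega$, with $\Omega=\{z\in\mathbb C^k:\phi(z)<0\}$. More precisely, let $d\ge2$ be an integer, $0<a<1$, let $\eta_n\in\mathbb C\setminus\{0\}$ with $|\eta_n|\le a^{d^n}$ for all $n\ge0$, and put $$F_n(z_1,\dots,z_k)=(\eta_nz_k,\;z_2^d+\eta_nz_1,\;z_3^d+\eta_nz_2,\;\dots,\;z_k^d+\eta_nz_{k-1}),$$ $$\Omega_{\{F_n\}}=\{z\in\mathbb C^k: F_n\circ\cdots\circ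 F_0(z)\to0\ \text{as}\ n\to\infty\}.$$ For $R>1+a$ let $V^+=\{z\in\mathbb C^k:\|z\|_\infty=|z_i|\ge R\text{ for some }2\le i\le k\}$ and $\mathcal A_R(z)=z+(0,2R,0,\dots,0)$. Then there is an invertible complex linear map $L$ of $\mathbb C^k$ such that $\mathcal A_R\circ L(\widetilde V)\subset V^+$, the set $L^{-1}\circ\mathcal A_R^{-1}(\Omega_{\{F_n\}})$ is a Short $\mathbb C^k$, and it does not intersect $\widetilde V$. -/

import Mathlib

open scoped NNReal ENNReal Topology

noncomputable section

namespace ShortCk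

/-! `ℂ^k` is `Fin k → ℂ`; its Mathlib norm is the sup norm `‖z‖_∞`.  The coordinates
`z_1, …, z_k` have the indices `0, …, k - 1`. -/

/-- The Euclidean unit ball of `ℂ^k`. -/
def unitBall (k : ℕ) : Set (Fin k → ℂ) :=
  {z | ∑ i, ‖z i‖ ^ 2 < 1}

/-- `U` and `W` (meant to be open) are biholomorphic. -/
def Biholomorphic {k : ℕ} (U W : Set (Fin k → ℂ)) : Prop :=
  ∃ f g : (Fin k → ℂ) → (Fin k → ℂ),
    DifferentiableOn ℂ f U ∧ DifferentiableOn ℂ g W ∧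
    Set.MapsTo f U W ∧ Set.MapsTo g W U ∧ Set.InvOn g f U W

/-- The infinitesimal Kobayashi (pseudo)metric of `Ω` at the point `p` in the direction `ξ`: the
infimum of the `α > 0` such that `α f'(0) = ξ` for some holomorphic `f` from the unit disc
to `Ω` with `f(0) = p`. -/
def kobayashiMetric {k : ℕ} (Ω : Set (Fin k → ℂ)) (p ξ : Fin k → ℂ) : ℝ≥0∞ :=
  ⨅ (α : ℝ≥0) (_ : 0 < α ∧ ∃ f : ℂ → (Fin k → ℂ),
      DifferentiableOn ℂ f (Metric.ball 0 1) ∧ Set.MapsTo f (Metric.ball 0 1) Ω ∧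
      f 0 = p ∧ ((α : ℝ) : ℂ) • deriv f 0 = ξ), (α : ℝ≥0∞)

/-- A real-valued (so nowhere `-∞`) function on `ℂ^k` is plurisubharmonic: it is upper
semicontinuous and satisfies the sub-mean value inequality on every circle of every complex line.
Upper semicontinuity bounds `φ` above on the circle, so the integrability clause says that the
mean value is not `-∞`, which the inequality for a finite `φ z` entails. -/
def IsPlurisubharmonic {k : ℕ} (φ : (Fin k → ℂ) → ℝ) : Prop :=
  UpperSemicontinuous φ ∧
  ∀ z w : Fin k → ℂ,
    CircleIntegrable (fun ζ : ℂ => φ (z + ζ • w)) 0 1 ∧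
    φ z ≤ Real.circleAverage (fun ζ : ℂ => φ (z + ζ • w)) 0 1

/-- A Short `ℂ^k`. -/
structure IsShortCk {k : ℕ} (Ω : Set (Fin k → ℂ)) : Prop where
  isOpen : IsOpen Ω
  /-- This includes that `Ω` is non-empty. -/
  isConnected : IsConnected Ω
  exhaustion : ∃ U : ℕ → Set (Fin k → ℂ),
    (∀ j, IsOpen (U j) ∧ U j ⊆ U (j + 1) ∧ Biholomorphic (U j) (unitBall k)) ∧
    Ω = ⋃ j, U j
  kobayashi_eq_zero : ∀ p ∈ Ω, ∀ ξ : Fin k → ℂ, kobayashiMetric Ω p ξ = 0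
  exists_psh : ∃ φ : (Fin k → ℂ) → ℝ,
    IsPlurisubharmonic φ ∧ BddBelow (Set.range φ) ∧ Ω = {z | φ z < 0} ∧
    ∃ p ∈ Ω, ∃ q ∈ Ω, φ p ≠ φ q

/-- `V ⊆ ℂ^k` is an affine algebraic variety (not necessarily irreducible) of codimension `c`;
the height of its ideal is the smallest codimension of a component, that is `k - dim V`. -/
def IsAlgebraicOfCodim {k : ℕ} (V : Set (Fin k → ℂ)) (c : ℕ) : Prop :=
  (∃ I : Ideal (MvPolynomial (Fin k) ℂ), V = MvPolynomial.zeroLocus ℂ I) ∧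
  (MvPolynomial.vanishingIdeal ℂ V).height = c

/-- `F(n) = F_n ∘ ⋯ ∘ F_0`. -/
def iterSeq {X : Type*} (F : ℕ → X → X) : ℕ → X → X
  | 0 => F 0
  | n + 1 => F (n + 1) ∘ iterSeq F n

/-- The non-autonomous basin of attraction of `(F_n)` at the origin. -/
def basin {k : ℕ} (F : ℕ → (Fin k → ℂ) → (Fin k → ℂ)) : Set (Fin k → ℂ) :=
  {z | Filter.Tendsto (fun n => iterSeq F n z) Filter.atTop (𝓝 0)}

/-- The map
`(z_1, …, z_k) ↦ (η z_k, z_2 ^ d + η z_1, z_3 ^ d + η z_2, …, z_k ^ d + η z_{k-1})`;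
`(finRotate k).symm` is the cyclic predecessor on the indices. -/
def shiftMap (k d : ℕ) (η : ℂ) (z : Fin k → ℂ) : Fin k → ℂ :=
  fun i => (if i.val = 0 then 0 else z i ^ d) + η * z ((finRotate k).symm i)

/-- `V⁺ = {z | ‖z‖_∞ = |z_i| ≥ R for some 2 ≤ i ≤ k}`. -/
def Vplus (k : ℕ) (R : ℝ) : Set (Fin k → ℂ) :=
  {z | ∃ i : Fin k, i.val ≠ 0 ∧ ‖z‖ = ‖z i‖ ∧ R ≤ ‖z i‖}

/-- The translation `z ↦ z + (0, 2R, 0, …, 0)`. -/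
def translate (k : ℕ) (R : ℝ) (z : Fin k → ℂ) : Fin k → ℂ :=
  fun i => z i + (if i.val = 1 then ((2 * R : ℝ) : ℂ) else 0)

end ShortCk

end

/-! An ideal of height at least two contains a non-zero polynomial, and after a linear change of
coordinates, a second one free of the first variable. The leading forms of these two bound the
first two coordinates on `V` by the others, and rescaling makes the bound as small as desired.
Translating the second coordinate by `2R` then moves `V` into `V⁺`, because either some later
coordinate is at least `R` and dominates, or the translated coordinate does.

The shift maps preserve `V⁺`, so their basin misses it. The basin is the increasing union of the
preimages, under the automorphisms `F(n)`, of a small Euclidean ball that the maps contract. By the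
Cauchy estimate `DF(n)(p) ξ → 0` at each point `p` of the basin, so pulling back by `F(n)` discs of
fixed size through `F(n)(p)` in the direction of `DF(n)(p) ξ` gives holomorphic discs through `p`
with derivatives arbitrarily large multiples of `ξ`, and the Kobayashi metric vanishes.

The plurisubharmonic function is the limit of the decreasing sequence
`d⁻ⁿ log (2 max (a ^ dⁿ) ‖F(n) z‖)`. It equals `log a` at the origin and is larger at the points of
the basin whose orbits follow the superattracting direction more slowly than `a ^ dⁿ`. -/

namespace ShortCk

section Elimination

open Polynomial

attribute [local instance] Polynomial.algebra Polynomial.isLocalization in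
theorem height_le_one_of_comap_C_eq_bot {A : Type*} [CommRing A] [IsDomain A]
    {I : Ideal A[X]} (hI : I.comap (C : A →+* A[X]) = ⊥) : I.height ≤ 1 := by
  let S := (nonZeroDivisors A).map (C : A →+* A[X])
  have hIS : Disjoint (I : Set A[X]) S := by
    refine Set.disjoint_right.mpr ?_
    rintro _ ⟨b, hb, rfl⟩ hbI
    have hb0 : b ∈ I.comap (C : A →+* A[X]) := hbI
    rw [hI, Ideal.mem_bot] at hb0
    exact nonZeroDivisors.ne_zero hb hb0
  obtain ⟨P, hP, hIP, hPS⟩ := Ideal.exists_le_prime_disjoint I S hIS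
  -- Localizing at `S` gives the polynomial ring over the fraction field, which has dimension one.
  let K := FractionRing A
  have hmap : (P.map (algebraMap A[X] K[X])).IsPrime :=
    IsLocalization.isPrime_of_isPrime_disjoint S K[X] P hP hPS.symm
  have hdim : ringKrullDim K[X] ≤ 1 := (Ring.krullDimLE_iff (n := 1)).mp inferInstance
  calc I.height ≤ P.height := Ideal.height_mono hIP
    _ = (P.map (algebraMap A[X] K[X])).height :=
      (IsLocalization.height_map_of_disjoint S P hPS.symm).symm
    _ ≤ 1 := by exact_mod_cast Ideal.height_le_ringKrullDim_of_isPrime.trans hdim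

end Elimination

section LinearCoordinates

open MvPolynomial

theorem exists_ne_zero_eval_tail_eq_zero {𝕜 : Type*} [Field 𝕜] {n : ℕ}
    {V : Set (Fin (n + 1) → 𝕜)} (hV : 2 ≤ (vanishingIdeal 𝕜 V).height) :
    ∃ g : MvPolynomial (Fin n) 𝕜, g ≠ 0 ∧ ∀ z ∈ V, eval (Fin.tail z) g = 0 := by
  let e := (finSuccEquiv 𝕜 n).symm
  have hJ : ((vanishingIdeal 𝕜 V).comap e.toRingEquiv).comap Polynomial.C ≠ ⊥ := by
    intro h
    have hle := height_le_one_of_comap_C_eq_bot h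
    rw [RingEquiv.height_comap] at hle
    exact absurd (hV.trans hle) (by norm_num)
  obtain ⟨g, hg, hg0⟩ := Submodule.exists_mem_ne_zero_of_ne_bot hJ
  refine ⟨g, hg0, fun z hz => ?_⟩
  have hgz : eval z (e (Polynomial.C g)) = 0 := hg z hz
  rw [← Fin.cons_self_tail z, eval_eq_eval_mv_eval', AlgEquiv.apply_symm_apply] at hgz
  simpa using hgz

/-- Substitution of the coordinates of a linear automorphism `L`, that is, the pullback of
polynomial functions along `L`. -/
noncomputable def pullback {𝕜 : Type*} [CommRing 𝕜] {σ : Type*} [Fintype σ] [DecidableEq σ]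
    (L : (σ → 𝕜) ≃ₗ[𝕜] (σ → 𝕜)) : MvPolynomial σ 𝕜 ≃ₐ[𝕜] MvPolynomial σ 𝕜 :=
  AlgEquiv.ofAlgHom (bind₁ (LinearMap.toMatrix' L.toLinearMap).toMvPolynomial)
    (bind₁ (LinearMap.toMatrix' L.symm.toLinearMap).toMvPolynomial)
    (algHom_ext fun i => by
      simp [← Matrix.toMvPolynomial_mul, ← LinearMap.toMatrix'_comp])
    (algHom_ext fun i => by
      simp [← Matrix.toMvPolynomial_mul, ← LinearMap.toMatrix'_comp])

theorem eval_pullback {𝕜 : Type*} [CommRing 𝕜] {σ : Type*} [Fintype σ] [DecidableEq σ]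
    (L : (σ → 𝕜) ≃ₗ[𝕜] (σ → 𝕜)) (z : σ → 𝕜) (p : MvPolynomial σ 𝕜) :
    eval z (pullback L p) = eval (L z) p := by
  have h : eval z (pullback L p) = eval (fun i => eval z
      ((LinearMap.toMatrix' L.toLinearMap).toMvPolynomial i)) p :=
    eval₂Hom_bind₁ _ _ _ _
  simpa [Matrix.toMvPolynomial_eval_eq_apply, LinearMap.toMatrix'_mulVec] using h

theorem height_vanishingIdeal_image {𝕜 : Type*} [Field 𝕜] {σ : Type*} [Finite σ]
    (L : (σ → 𝕜) ≃ₗ[𝕜] (σ → 𝕜)) (V : Set (σ → 𝕜)) :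
    (vanishingIdeal 𝕜 (L '' V)).height = (vanishingIdeal 𝕜 V).height := by
  classical
  have := Fintype.ofFinite σ
  rw [← RingEquiv.height_comap (pullback L).toRingEquiv (vanishingIdeal 𝕜 V)]
  congr 1
  ext p
  simp [Ideal.mem_comap, aeval_eq_eval, eval_pullback]

theorem eval_smul_of_isHomogeneous {R σ : Type*} [CommSemiring R] {p : MvPolynomial σ R} {n : ℕ}
    (hp : p.IsHomogeneous n) (t : R) (x : σ → R) : eval (t • x) p = t ^ n * eval x p := by
  rw [eval_eq, eval_eq, Finset.mul_sum]
  refine Finset.sum_congr rfl fun s hs => ?_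
  have hdeg : ∑ i ∈ s.support, s i = n := by
    rw [← Finsupp.degree_apply, Finsupp.degree_eq_weight_one]
    exact hp (mem_support_iff.mp hs)
  simp only [Pi.smul_apply, smul_eq_mul, mul_pow, Finset.prod_mul_distrib,
    Finset.prod_pow_eq_pow_sum, hdeg]
  ring

theorem homogeneousComponent_totalDegree_ne_zero {R σ : Type*} [CommSemiring R]
    {p : MvPolynomial σ R} (hp : p ≠ 0) : homogeneousComponent p.totalDegree p ≠ 0 := by
  obtain ⟨s, hs, hdeg⟩ := Finset.exists_mem_eq_sup p.support (support_nonempty.mpr hp)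
    (fun s => s.sum fun _ e => e)
  refine ne_zero_iff.mpr ⟨s, ?_⟩
  have hs' : s.degree = p.totalDegree := hdeg.symm
  rw [coeff_homogeneousComponent, if_pos hs']
  exact mem_support_iff.mp hs

theorem eventually_eval_inv_smul_ne_zero {𝕜 σ : Type*} [Field 𝕜] [TopologicalSpace 𝕜]
    [IsTopologicalRing 𝕜] [T1Space 𝕜] {p : MvPolynomial σ 𝕜} {v : σ → 𝕜}
    (hv : eval v (homogeneousComponent p.totalDegree p) ≠ 0) :
    ∀ᶠ q : 𝕜 × (σ → 𝕜) in 𝓝 (0, v), q.1 ≠ 0 → eval (q.1⁻¹ • q.2) p ≠ 0 := by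
  set m := p.totalDegree
  let H : 𝕜 × (σ → 𝕜) → 𝕜 := fun q =>
    ∑ j ∈ Finset.range (m + 1), q.1 ^ (m - j) * eval q.2 (homogeneousComponent j p)
  have hcont : Continuous H := continuous_finsetSum _ fun j _ =>
    (continuous_fst.pow _).mul ((continuous_eval _).comp continuous_snd)
  have hH0 : H (0, v) = eval v (homogeneousComponent m p) := by
    simp only [H]
    rw [Finset.sum_range_succ, Finset.sum_eq_zero fun j hj => ?_]
    · simp
    · rw [zero_pow (by have := Finset.mem_range.mp hj; lia), zero_mul]
  have hH (q : 𝕜 × (σ → 𝕜)) (hq : q.1 ≠ 0) : H q = q.1 ^ m * eval (q.1⁻¹ • q.2) p := by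
    conv_rhs => rw [← sum_homogeneousComponent p, map_sum, Finset.mul_sum]
    refine Finset.sum_congr rfl fun j hj => ?_
    have hjm : j ≤ m := Nat.lt_succ_iff.mp (Finset.mem_range.mp hj)
    rw [eval_smul_of_isHomogeneous (homogeneousComponent_isHomogeneous j p), pow_sub₀ _ hq hjm,
      inv_pow, mul_assoc]
  filter_upwards [hcont.continuousAt.eventually_ne (hH0.trans_ne hv)] with q hq hq0
  rw [hH q hq0] at hq
  exact right_ne_zero_of_mul hq

variable {𝕜 : Type*} [RCLike 𝕜] {n : ℕ}

theorem exists_linearEquiv_norm_zero_le {p : MvPolynomial (Fin (n + 1)) 𝕜} (hp : p ≠ 0) :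
    ∃ (L : (Fin (n + 1) → 𝕜) ≃ₗ[𝕜] (Fin (n + 1) → 𝕜)) (c : ℝ), 0 < c ∧
      ∀ z, eval z p = 0 → ‖L z 0‖ ≤ c * (1 + ‖Fin.tail (L z)‖) := by
  -- The factor `X 0` forces `v ≠ 0`, also when `p` is constant.
  obtain ⟨v, hv⟩ : ∃ v, eval v (homogeneousComponent p.totalDegree p * X 0) ≠ 0 := by
    by_contra! h
    exact mul_ne_zero (homogeneousComponent_totalDegree_ne_zero hp) (X_ne_zero 0)
      (MvPolynomial.funext fun x => by rw [h x, map_zero])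
  rw [map_mul, eval_X] at hv
  have hv0 : v ≠ 0 := fun h => right_ne_zero_of_mul hv (by simp [h])
  obtain ⟨L, hL⟩ := SeparatingDual.exists_continuousLinearEquiv_apply_eq (R := 𝕜) hv0
    (show (Pi.single 0 1 : Fin (n + 1) → 𝕜) ≠ 0 by simp)
  have hev : ∀ᶠ q : 𝕜 × (Fin (n + 1) → 𝕜) in 𝓝 (0, Pi.single 0 1),
      q.1 ≠ 0 → eval (q.1⁻¹ • L.symm q.2) p ≠ 0 := by
    have hlim : Filter.Tendsto (Prod.map id L.symm) (𝓝 ((0 : 𝕜), Pi.single 0 1)) (𝓝 (0, v)) := by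
      rw [← L.symm_apply_apply v, hL]
      exact (continuous_id.prodMap L.symm.continuous).tendsto _
    exact hlim.eventually (eventually_eval_inv_smul_ne_zero (left_ne_zero_of_mul hv))
  obtain ⟨δ, hδ, hball⟩ := Metric.eventually_nhds_iff.mp hev
  refine ⟨L.toLinearEquiv, δ⁻¹, inv_pos.mpr hδ, fun z hz => ?_⟩
  by_contra! hlt
  set w := L z
  have hpos : 0 < ‖w 0‖ := lt_of_le_of_lt (by positivity) hlt
  have hw0 : w 0 ≠ 0 := norm_pos_iff.mp hpos
  have hbig : 1 + ‖Fin.tail w‖ < δ * ‖w 0‖ := (inv_mul_lt_iff₀ hδ).mp hlt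
  have hinv : dist (w 0)⁻¹ 0 < δ := by
    rw [dist_zero_right, norm_inv, inv_lt_iff_one_lt_mul₀ hpos]
    nlinarith [norm_nonneg (Fin.tail w)]
  have hdir : dist ((w 0)⁻¹ • w) (Pi.single 0 1) < δ := by
    refine (dist_pi_lt_iff hδ).mpr (Fin.cases (by simp [hw0, hδ]) fun i => ?_)
    have hi : ‖w i.succ‖ ≤ ‖Fin.tail w‖ := norm_le_pi_norm (Fin.tail w) i
    simp only [Pi.smul_apply, smul_eq_mul, ne_eq, Fin.succ_ne_zero, not_false_eq_true,
      Pi.single_eq_of_ne, dist_zero_right, norm_mul, norm_inv]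
    rw [inv_mul_lt_iff₀ hpos]
    linarith
  refine hball (y := ((w 0)⁻¹, (w 0)⁻¹ • w)) (max_lt hinv hdir) (inv_ne_zero hw0) ?_
  simp [w, inv_inv, smul_smul, hw0, hz]

/-- The linear automorphism `(z₀, z') ↦ (u z₀, M z')`. -/
noncomputable def consMap (u : 𝕜ˣ) (M : (Fin n → 𝕜) ≃ₗ[𝕜] (Fin n → 𝕜)) :
    (Fin (n + 1) → 𝕜) ≃ₗ[𝕜] (Fin (n + 1) → 𝕜) :=
  (Fin.consLinearEquiv 𝕜 fun _ => 𝕜).symm ≪≫ₗ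
    (LinearEquiv.smulOfUnit u).prodCongr M ≪≫ₗ Fin.consLinearEquiv 𝕜 fun _ => 𝕜

@[simp]
theorem consMap_zero (u : 𝕜ˣ) (M : (Fin n → 𝕜) ≃ₗ[𝕜] (Fin n → 𝕜)) (z : Fin (n + 1) → 𝕜) :
    consMap u M z 0 = u * z 0 :=
  rfl

@[simp]
theorem tail_consMap (u : 𝕜ˣ) (M : (Fin n → 𝕜) ≃ₗ[𝕜] (Fin n → 𝕜)) (z : Fin (n + 1) → 𝕜) :
    Fin.tail (consMap u M z) = M (Fin.tail z) :=
  rfl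

theorem exists_unit_norm_mul_le (c : ℝ) {ε : ℝ} (hε : 0 < ε) : ∃ u : 𝕜ˣ, ‖(u : 𝕜)‖ * c ≤ ε := by
  obtain ⟨x, hx, hxε⟩ := NormedField.exists_norm_lt 𝕜 (r := ε / (|c| + 1)) (by positivity)
  refine ⟨Units.mk0 x (norm_pos_iff.mp hx), ?_⟩
  rw [lt_div_iff₀ (by positivity)] at hxε
  calc ‖x‖ * c ≤ ‖x‖ * (|c| + 1) := by gcongr; linarith [le_abs_self c]
    _ ≤ ε := hxε.le

theorem exists_linearEquiv_norm_zero_le_mul {p : MvPolynomial (Fin (n + 1)) 𝕜} (hp : p ≠ 0)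
    {ε : ℝ} (hε : 0 < ε) :
    ∃ L : (Fin (n + 1) → 𝕜) ≃ₗ[𝕜] (Fin (n + 1) → 𝕜),
      ∀ z, eval z p = 0 → ‖L z 0‖ ≤ ε * (1 + ‖Fin.tail (L z)‖) := by
  obtain ⟨L, c, -, hL⟩ := exists_linearEquiv_norm_zero_le hp
  obtain ⟨u, hu⟩ := exists_unit_norm_mul_le (𝕜 := 𝕜) c hε
  refine ⟨L.trans (consMap u (LinearEquiv.refl 𝕜 _)), fun z hz => ?_⟩
  simp only [LinearEquiv.trans_apply, consMap_zero, tail_consMap, LinearEquiv.refl_apply, norm_mul]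
  calc ‖(u : 𝕜)‖ * ‖L z 0‖ ≤ ‖(u : 𝕜)‖ * (c * (1 + ‖Fin.tail (L z)‖)) := by
        gcongr; exact hL z hz
    _ = ‖(u : 𝕜)‖ * c * (1 + ‖Fin.tail (L z)‖) := by ring
    _ ≤ ε * (1 + ‖Fin.tail (L z)‖) := by gcongr

theorem one_add_norm_le_of_norm_zero_le {w : Fin (n + 1) → 𝕜} {ε : ℝ} (hε : 0 ≤ ε)
    (hw : ‖w 0‖ ≤ ε * (1 + ‖Fin.tail w‖)) : 1 + ‖w‖ ≤ (1 + ε) * (1 + ‖Fin.tail w‖) := by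
  have hnorm : ‖w‖ ≤ ‖Fin.tail w‖ + ε * (1 + ‖Fin.tail w‖) := by
    refine (pi_norm_le_iff_of_nonneg (by positivity)).mpr (Fin.cases ?_ fun i => ?_)
    · exact hw.trans (le_add_of_nonneg_left (norm_nonneg _))
    · exact (norm_le_pi_norm (Fin.tail w) i).trans (le_add_of_nonneg_right (by positivity))
  linarith

theorem exists_linearEquiv_norm_le {V : Set (Fin (n + 2) → 𝕜)}
    (hV : 2 ≤ (vanishingIdeal 𝕜 V).height) {ε : ℝ} (hε : 0 < ε) :
    ∃ L : (Fin (n + 2) → 𝕜) ≃ₗ[𝕜] (Fin (n + 2) → 𝕜), ∀ z ∈ V,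
      ‖L z 0‖ ≤ ε * (1 + ‖Fin.tail (Fin.tail (L z))‖) ∧
      ‖L z 1‖ ≤ ε * (1 + ‖Fin.tail (Fin.tail (L z))‖) := by
  have hV0 : vanishingIdeal 𝕜 V ≠ ⊥ := fun h => by simp [h] at hV
  obtain ⟨f, hf, hf0⟩ := Submodule.exists_mem_ne_zero_of_ne_bot hV0
  obtain ⟨L, c, hc, hL⟩ := exists_linearEquiv_norm_zero_le hf0
  rw [← height_vanishingIdeal_image L] at hV
  obtain ⟨g, hg0, hg⟩ := exists_ne_zero_eval_tail_eq_zero hV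
  obtain ⟨M, hM⟩ := exists_linearEquiv_norm_zero_le_mul hg0 hε
  obtain ⟨K, hK, hMK⟩ := M.symm.toLinearMap.toContinuousLinearMap.bound
  obtain ⟨u, hu⟩ := exists_unit_norm_mul_le (𝕜 := 𝕜) (c * ((1 + K) * (1 + ε))) hε
  refine ⟨L.trans (consMap u M), fun z hz => ?_⟩
  set y := Fin.tail (L z)
  have hMy : ‖M y 0‖ ≤ ε * (1 + ‖Fin.tail (M y)‖) := hM y (hg _ ⟨z, hz, rfl⟩)
  refine ⟨?_, hMy⟩
  have hy : 1 + ‖y‖ ≤ (1 + K) * (1 + ‖M y‖) := by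
    have hyK : ‖y‖ ≤ K * ‖M y‖ := by simpa using hMK (M y)
    nlinarith [norm_nonneg (M y)]
  calc ‖(u : 𝕜) * L z 0‖ = ‖(u : 𝕜)‖ * ‖L z 0‖ := norm_mul _ _
    _ ≤ ‖(u : 𝕜)‖ * (c * (1 + ‖y‖)) := by gcongr; exact hL z (hf z hz)
    _ ≤ ‖(u : 𝕜)‖ * (c * ((1 + K) * ((1 + ε) * (1 + ‖Fin.tail (M y)‖)))) := by
        gcongr
        exact hy.trans (by gcongr; exact one_add_norm_le_of_norm_zero_le hε.le hMy)
    _ = ‖(u : 𝕜)‖ * (c * ((1 + K) * (1 + ε))) * (1 + ‖Fin.tail (M y)‖) := by ring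
    _ ≤ ε * (1 + ‖Fin.tail (M y)‖) := by gcongr

end LinearCoordinates

section Vplus

theorem exists_norm_apply_eq_norm {ι : Type*} {E : ι → Type*} [Fintype ι] [Nonempty ι]
    [∀ i, SeminormedAddCommGroup (E i)] (x : ∀ i, E i) : ∃ i, ‖x i‖ = ‖x‖ := by
  obtain ⟨i, hi⟩ := Finite.exists_max fun i => ‖x i‖
  exact ⟨i, le_antisymm (norm_le_pi_norm x i) ((pi_norm_le_iff_of_nonneg (norm_nonneg _)).mpr hi)⟩

theorem mem_Vplus_of_norm_le {k : ℕ} {R : ℝ} {y : Fin k → ℂ} {i : Fin k} (hi : i.val ≠ 0)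
    (hRi : R ≤ ‖y i‖) (h0 : ∀ j : Fin k, j.val = 0 → ‖y j‖ ≤ ‖y i‖) : y ∈ Vplus k R := by
  have : Nonempty (Fin k) := ⟨i⟩
  obtain ⟨j, hj⟩ := exists_norm_apply_eq_norm y
  by_cases hj0 : j.val = 0
  · exact ⟨i, hi, le_antisymm (hj ▸ h0 j hj0) (norm_le_pi_norm y i), hRi⟩
  · exact ⟨j, hj0, hj.symm, hRi.trans ((norm_le_pi_norm y i).trans hj.ge)⟩

theorem translate_mem_Vplus {n : ℕ} {R : ℝ} (hR : 1 < R) {w : Fin (n + 2) → ℂ}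
    (h0 : ‖w 0‖ ≤ 1 / 2 * (1 + ‖Fin.tail (Fin.tail w)‖))
    (h1 : ‖w 1‖ ≤ 1 / 2 * (1 + ‖Fin.tail (Fin.tail w)‖)) :
    translate (n + 2) R w ∈ Vplus (n + 2) R := by
  set y := translate (n + 2) R w
  set t := ‖Fin.tail (Fin.tail w)‖
  have hy0 : y 0 = w 0 := by simp [y, translate]
  have hmem (i : Fin (n + 2)) (hi : i ≠ 0) (hRi : R ≤ ‖y i‖) (h0i : ‖w 0‖ ≤ ‖y i‖) :
      y ∈ Vplus (n + 2) R := by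
    refine mem_Vplus_of_norm_le (Fin.val_ne_zero_iff.mpr hi) hRi fun j hj => ?_
    rwa [Fin.val_eq_zero_iff.mp hj, hy0]
  rcases lt_or_ge t R with ht | ht
  · have hy1 : 2 * R - ‖w 1‖ ≤ ‖y 1‖ := by
      have := norm_sub_norm_le ((2 * R : ℝ) : ℂ) (-w 1)
      rw [norm_neg, sub_neg_eq_add, Complex.norm_real, Real.norm_of_nonneg (by linarith)] at this
      simpa [y, translate, add_comm] using this
    exact hmem 1 (by simp) (by linarith) (by linarith)
  · have : Nonempty (Fin n) := by
      by_contra hn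
      rw [not_nonempty_iff] at hn
      have ht0 : t = 0 := by simp [t, Subsingleton.elim (Fin.tail (Fin.tail w)) 0]
      linarith
    obtain ⟨i, hi⟩ := exists_norm_apply_eq_norm (Fin.tail (Fin.tail w))
    have hyi : ‖y i.succ.succ‖ = t := by
      refine Eq.trans ?_ hi
      simp [y, translate, Fin.tail]
    exact hmem i.succ.succ (by simp) (by linarith) (by linarith)

end Vplus

section Plurisubharmonic

open Real

section CircleAverage

variable {g : ℕ → ℂ → ℝ} {x : ℂ} {r c : ℝ}

theorem circleIntegrable_iInf (hg : ∀ n, CircleIntegrable (g n) x r) (hc : ∀ n ζ, c ≤ g n ζ) :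
    CircleIntegrable (fun ζ => ⨅ n, g n ζ) x r := by
  have hmeas : AEMeasurable (fun θ => ⨅ n, g n (circleMap x r θ))
      (MeasureTheory.volume.restrict (Set.uIoc 0 (2 * π))) :=
    AEMeasurable.iInf fun n => (hg n).def'.aestronglyMeasurable.aemeasurable
  refine ((intervalIntegrable_const (c := |c|)).add (hg 0).abs).mono_fun
    hmeas.aestronglyMeasurable (Filter.Eventually.of_forall fun θ => ?_)
  have hle : ⨅ n, g n (circleMap x r θ) ≤ g 0 (circleMap x r θ) :=
    ciInf_le ⟨c, Set.forall_mem_range.mpr fun n => hc n _⟩ 0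
  have hge : c ≤ ⨅ n, g n (circleMap x r θ) := le_ciInf fun n => hc n _
  exact (abs_le_max_abs_abs hge hle).trans
    ((max_le_add_of_nonneg (abs_nonneg _) (abs_nonneg _)).trans (le_abs_self _))

theorem tendsto_circleAverage_iInf (hg : ∀ n, CircleIntegrable (g n) x r) (hanti : Antitone g)
    (hc : ∀ n ζ, c ≤ g n ζ) :
    Filter.Tendsto (fun n => circleAverage (g n) x r) Filter.atTop
      (𝓝 (circleAverage (fun ζ => ⨅ n, g n ζ) x r)) := by
  refine (intervalIntegral.tendsto_integral_filter_of_dominated_convergence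
    (fun θ => |c| + |g 0 (circleMap x r θ)|) ?_ ?_ ?_ ?_).const_smul _
  · exact Filter.Eventually.of_forall fun n => (hg n).def'.aestronglyMeasurable
  · refine Filter.Eventually.of_forall fun n => Filter.Eventually.of_forall fun θ _ => ?_
    exact (abs_le_max_abs_abs (hc n _) (hanti (Nat.zero_le n) _)).trans
      (max_le_add_of_nonneg (abs_nonneg _) (abs_nonneg _))
  · exact intervalIntegrable_const.add (hg 0).abs
  · exact Filter.Eventually.of_forall fun θ _ => tendsto_atTop_ciInf
      (fun m n hmn => hanti hmn _) ⟨c, Set.forall_mem_range.mpr fun n => hc n _⟩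

theorem log_norm_le_circleAverage {f : ℂ → ℂ} (hf : AnalyticOnNhd ℂ f (Metric.closedBall x |r|))
    (hr : r ≠ 0) (hx : f x ≠ 0) :
    log ‖f x‖ ≤ circleAverage (fun ζ => log ‖f ζ‖) x r := by
  -- Jensen's formula: the difference of the two sides is a sum over the zeros in the disc.
  rw [hf.circleAverage_log_norm hr hx]
  refine le_add_of_nonneg_left (finsum_nonneg fun u => ?_)
  by_cases hu : u ∈ Metric.closedBall x |r|
  · refine mul_nonneg ?_ ?_
    · exact_mod_cast (MeromorphicOn.AnalyticOnNhd.divisor_nonneg hf) u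
    · rw [← log_abs, abs_mul, abs_inv, abs_norm, ← dist_eq_norm, dist_comm]
      rcases (dist_nonneg (x := u) (y := x)).eq_or_lt with h | h
      · simp [← h]
      · exact log_nonneg (by
          rw [← div_eq_mul_inv, one_le_div h]
          exact Metric.mem_closedBall.mp hu)
  · simp [Function.locallyFinsuppWithin.apply_eq_zero_of_notMem _ hu]

theorem posLog_norm_le_circleAverage {ι : Type*} [Fintype ι] {f : ℂ → ι → ℂ}
    (hf : Differentiable ℂ f) (hr : r ≠ 0) :
    log⁺ ‖f x‖ ≤ circleAverage (fun ζ => log⁺ ‖f ζ‖) x r := by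
  rcases le_or_gt ‖f x‖ 1 with h | h
  · rw [(posLog_eq_zero_iff _).mpr (by rwa [abs_norm])]
    exact circleAverage_nonneg_of_nonneg fun _ _ => posLog_nonneg
  · have : Nonempty ι := by
      by_contra hι
      rw [not_nonempty_iff] at hι
      exact absurd h (by simp [Subsingleton.elim (f x) 0])
    obtain ⟨i, hi⟩ := exists_norm_apply_eq_norm (f x)
    have hfi : Differentiable ℂ fun ζ => f ζ i := differentiable_pi.mp hf i
    have hx : f x i ≠ 0 := norm_pos_iff.mp (by rw [hi]; linarith)
    have hcont : Continuous fun ζ => log⁺ ‖f ζ‖ := continuous_posLog.comp hf.continuous.norm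
    rw [posLog_eq_log (by rw [abs_norm]; exact h.le), ← hi]
    refine (log_norm_le_circleAverage (fun z _ => hfi.analyticAt z) hr hx).trans
      (circleAverage_mono ?_ hcont.continuousOn.circleIntegrable' fun ζ _ => ?_)
    · exact MeromorphicOn.circleIntegrable_log_norm fun z _ => (hfi.analyticAt z).meromorphicAt
    · exact (le_max_right _ _).trans (posLog_le_posLog (norm_nonneg _) (norm_le_pi_norm (f ζ) i))

end CircleAverage

variable {k : ℕ} {φ : (Fin k → ℂ) → ℝ}

theorem IsPlurisubharmonic.const_add (hφ : IsPlurisubharmonic φ) (c : ℝ) :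
    IsPlurisubharmonic fun z => c + φ z := by
  refine ⟨upperSemicontinuous_const.add hφ.1, fun z w => ?_⟩
  obtain ⟨hint, hle⟩ := hφ.2 z w
  have hconst : CircleIntegrable (fun _ => c) 0 1 := circleIntegrable_const c 0 1
  refine ⟨hconst.add hint, ?_⟩
  rw [circleAverage_fun_add hconst hint, circleAverage_const]
  exact add_le_add_right hle c

theorem IsPlurisubharmonic.const_mul (hφ : IsPlurisubharmonic φ) {c : ℝ} (hc : 0 ≤ c) :
    IsPlurisubharmonic fun z => c * φ z := by
  refine ⟨?_, fun z w => ?_⟩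
  · exact (continuous_const_mul c).comp_upperSemicontinuous hφ.1 (monotone_mul_left_of_nonneg hc)
  · obtain ⟨hint, hle⟩ := hφ.2 z w
    refine ⟨hint.const_smul (a := c), ?_⟩
    have hsmul : circleAverage (fun ζ => c * φ (z + ζ • w)) 0 1 =
        c * circleAverage (fun ζ => φ (z + ζ • w)) 0 1 :=
      circleAverage_fun_smul (a := c)
    rw [hsmul]
    exact mul_le_mul_of_nonneg_left hle hc

theorem IsPlurisubharmonic.comp_affine (hφ : IsPlurisubharmonic φ) {l : ℕ}
    (L : (Fin l → ℂ) →ₗ[ℂ] (Fin k → ℂ)) (b : Fin k → ℂ) :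
    IsPlurisubharmonic fun z => φ (L z + b) := by
  refine ⟨hφ.1.comp (L.continuous_on_pi.add continuous_const), fun z w => ?_⟩
  have hline (ζ : ℂ) : L (z + ζ • w) + b = L z + b + ζ • L w := by
    rw [map_add, map_smul, add_right_comm]
  simp only [hline]
  exact hφ.2 (L z + b) (L w)

theorem isPlurisubharmonic_posLog_norm {ι : Type*} [Fintype ι] {f : (Fin k → ℂ) → ι → ℂ}
    (hf : Differentiable ℂ f) : IsPlurisubharmonic fun z => log⁺ ‖f z‖ := by
  have hcont : Continuous fun z => log⁺ ‖f z‖ := continuous_posLog.comp hf.continuous.norm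
  refine ⟨hcont.upperSemicontinuous, fun z w => ⟨?_, ?_⟩⟩
  · exact (hcont.comp (g := fun z => log⁺ ‖f z‖) (by fun_prop)).continuousOn.circleIntegrable'
  · have hline : Differentiable ℂ fun ζ : ℂ => f (z + ζ • w) := hf.comp (by fun_prop)
    simpa using posLog_norm_le_circleAverage hline one_ne_zero (x := 0)

theorem isPlurisubharmonic_iInf {u : ℕ → (Fin k → ℂ) → ℝ} {c : ℝ}
    (hu : ∀ n, IsPlurisubharmonic (u n)) (hanti : Antitone u) (hc : ∀ n z, c ≤ u n z) :
    IsPlurisubharmonic fun z => ⨅ n, u n z := by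
  have hbdd (z : Fin k → ℂ) : BddBelow (Set.range fun n => u n z) :=
    ⟨c, Set.forall_mem_range.mpr fun n => hc n z⟩
  refine ⟨upperSemicontinuous_ciInf hbdd fun n => (hu n).1, fun z w => ?_⟩
  let g : ℕ → ℂ → ℝ := fun n ζ => u n (z + ζ • w)
  have hg (n : ℕ) : CircleIntegrable (g n) 0 1 := ((hu n).2 z w).1
  have hganti : Antitone g := fun m n hmn ζ => hanti hmn _
  refine ⟨circleIntegrable_iInf hg fun n ζ => hc n _, ?_⟩
  refine ge_of_tendsto' (tendsto_circleAverage_iInf hg hganti fun n ζ => hc n _) fun n => ?_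
  exact (ciInf_le (hbdd z) n).trans ((hu n).2 z w).2

end Plurisubharmonic

section Automorphism

variable {E : Type*} [NormedAddCommGroup E] [NormedSpace ℂ E]

/-- `f` is a biholomorphic map of `E` onto itself. -/
def IsAutomorphism (f : E → E) : Prop :=
  Differentiable ℂ f ∧
    ∃ g, Differentiable ℂ g ∧ Function.LeftInverse g f ∧ Function.RightInverse g f

namespace IsAutomorphism

variable {f g : E → E}

theorem comp (hg : IsAutomorphism g) (hf : IsAutomorphism f) : IsAutomorphism (g ∘ f) := by
  obtain ⟨hgd, g', hg', hgl, hgr⟩ := hg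
  obtain ⟨hfd, f', hf', hfl, hfr⟩ := hf
  exact ⟨hgd.comp hfd, f' ∘ g', hf'.comp hg', hgl.comp hfl, hgr.comp hfr⟩

theorem iterSeq {F : ℕ → E → E} (hF : ∀ n, IsAutomorphism (F n)) :
    ∀ n, IsAutomorphism (iterSeq F n)
  | 0 => hF 0
  | n + 1 => (hF (n + 1)).comp (IsAutomorphism.iterSeq hF n)

theorem isConnected_preimage (hf : IsAutomorphism f) {U : Set E} (hU : IsConnected U) :
    IsConnected (f ⁻¹' U) := by
  obtain ⟨-, g, hg, hl, hr⟩ := hf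
  rw [← Set.image_eq_preimage_of_inverse hr hl]
  exact hU.image g hg.continuous.continuousOn

end IsAutomorphism

theorem isAutomorphism_affine [FiniteDimensional ℂ E] (L : E ≃ₗ[ℂ] E) (b : E) :
    IsAutomorphism fun z => L z + b := by
  let L' := L.toContinuousLinearEquiv
  refine ⟨L'.differentiable.add_const b, fun z => L'.symm (z - b),
    L'.symm.differentiable.comp (differentiable_id.sub_const b), fun z => ?_, fun z => ?_⟩
  · change L'.symm (L' z + b - b) = z
    rw [add_sub_cancel_right, L'.symm_apply_apply]
  · change L' (L'.symm (z - b)) + b = z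
    rw [L'.apply_symm_apply, sub_add_cancel]

theorem iterSeq_apply_fixed {X : Type*} {F : ℕ → X → X} {x : X} (hF : ∀ n, F n x = x) :
    ∀ n, iterSeq F n x = x
  | 0 => hF 0
  | n + 1 => by rw [iterSeq, Function.comp_apply, iterSeq_apply_fixed hF n, hF]

variable {k : ℕ}

theorem Biholomorphic.preimage {U W : Set (Fin k → ℂ)} {h : (Fin k → ℂ) → (Fin k → ℂ)}
    (hUW : Biholomorphic U W) (hh : IsAutomorphism h) : Biholomorphic (h ⁻¹' U) W := by
  obtain ⟨f, g, hf, hg, hfU, hgW, hl, hr⟩ := hUW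
  obtain ⟨hd, h', hd', hl', hr'⟩ := hh
  refine ⟨f ∘ h, h' ∘ g, hf.comp hd.differentiableOn (Set.mapsTo_preimage h U),
    hd'.comp_differentiableOn hg, fun z hz => hfU hz, fun w hw => ?_, fun z hz => ?_,
    fun w hw => ?_⟩
  · simpa only [Set.mem_preimage, Function.comp_apply, hr' _] using hgW hw
  · rw [Function.comp_apply, Function.comp_apply, hl hz, hl']
  · rw [Function.comp_apply, Function.comp_apply, hr', hr hw]

theorem kobayashiMetric_le_of_mapsTo {l : ℕ} {Ω : Set (Fin k → ℂ)} {Ω' : Set (Fin l → ℂ)}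
    {h : (Fin k → ℂ) → (Fin l → ℂ)} (hΩ : IsOpen Ω) (hh : DifferentiableOn ℂ h Ω)
    (hm : Set.MapsTo h Ω Ω') (p ξ : Fin k → ℂ) :
    kobayashiMetric Ω' (h p) (fderiv ℂ h p ξ) ≤ kobayashiMetric Ω p ξ := by
  refine le_iInf₂ fun α ⟨hα, f, hf, hfm, hf0, hfd⟩ => ?_
  refine iInf₂_le α ⟨hα, h ∘ f, hh.comp hf hfm, hm.comp hfm, congrArg h hf0, ?_⟩
  have hp : p ∈ Ω := hf0 ▸ hfm (Metric.mem_ball_self one_pos)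
  have hhp : HasFDerivAt h (fderiv ℂ h p) (f 0) := by
    rw [hf0]
    exact (hh.differentiableAt (hΩ.mem_nhds hp)).hasFDerivAt
  have hf' : HasDerivAt f (deriv f 0) 0 :=
    (hf.differentiableAt (Metric.ball_mem_nhds 0 one_pos)).hasDerivAt
  rw [(hhp.comp_hasDerivAt 0 hf').deriv, ← map_smul, hfd]

theorem kobayashiMetric_anti {Ω Ω' : Set (Fin k → ℂ)} (hΩ : IsOpen Ω) (h : Ω ⊆ Ω')
    (p ξ : Fin k → ℂ) : kobayashiMetric Ω' p ξ ≤ kobayashiMetric Ω p ξ := by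
  simpa using kobayashiMetric_le_of_mapsTo hΩ differentiableOn_id h p ξ

theorem IsAutomorphism.kobayashiMetric_preimage_le {f : (Fin k → ℂ) → (Fin k → ℂ)}
    (hf : IsAutomorphism f) {Ω : Set (Fin k → ℂ)} (hΩ : IsOpen Ω) (p ξ : Fin k → ℂ) :
    kobayashiMetric (f ⁻¹' Ω) p ξ ≤ kobayashiMetric Ω (f p) (fderiv ℂ f p ξ) := by
  obtain ⟨hd, g, hg, hl, hr⟩ := hf
  have hm : Set.MapsTo g Ω (f ⁻¹' Ω) := fun w hw => by rwa [Set.mem_preimage, hr w]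
  have hgf : fderiv ℂ g (f p) (fderiv ℂ f p ξ) = ξ := by
    have hcomp := (hg (f p)).hasFDerivAt.comp p (hd p).hasFDerivAt
    rw [hl.comp_eq_id] at hcomp
    exact DFunLike.congr_fun (hcomp.unique (hasFDerivAt_id p)) ξ
  simpa only [hl p, hgf] using
    kobayashiMetric_le_of_mapsTo hΩ hg.differentiableOn hm (f p) (fderiv ℂ f p ξ)

theorem kobayashiMetric_smul_le {Ω : Set (Fin k → ℂ)} {p v : Fin k → ℂ} {ε : ℝ≥0} (hε : 0 < ε)
    (h : ∀ ζ : ℂ, ‖ζ‖ < 1 → p + ζ • v ∈ Ω) :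
    kobayashiMetric Ω p (((ε : ℝ) : ℂ) • v) ≤ ε := by
  have hline : HasDerivAt (fun ζ : ℂ => p + ζ • v) v 0 := by
    simpa using ((hasDerivAt_id (0 : ℂ)).smul_const v).const_add p
  refine iInf₂_le ε ⟨hε, fun ζ => p + ζ • v, by fun_prop, fun ζ hζ => ?_, by simp, ?_⟩
  · exact h ζ (mem_ball_zero_iff.mp hζ)
  · rw [hline.deriv]

theorem IsShortCk.preimage_affine {Ω : Set (Fin k → ℂ)} (h : IsShortCk Ω)
    (L : (Fin k → ℂ) ≃ₗ[ℂ] (Fin k → ℂ)) (b : Fin k → ℂ) :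
    IsShortCk ((fun z => L z + b) ⁻¹' Ω) where
  isOpen := h.isOpen.preimage (isAutomorphism_affine L b).1.continuous
  isConnected := (isAutomorphism_affine L b).isConnected_preimage h.isConnected
  exhaustion := by
    obtain ⟨U, hU, rfl⟩ := h.exhaustion
    exact ⟨fun j => (fun z => L z + b) ⁻¹' U j, fun j =>
      ⟨(hU j).1.preimage (isAutomorphism_affine L b).1.continuous, Set.preimage_mono (hU j).2.1,
        (hU j).2.2.preimage (isAutomorphism_affine L b)⟩, Set.preimage_iUnion⟩
  kobayashi_eq_zero p hp ξ := le_antisymm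
    (((isAutomorphism_affine L b).kobayashiMetric_preimage_le h.isOpen p ξ).trans_eq
      (h.kobayashi_eq_zero _ hp _)) zero_le
  exists_psh := by
    obtain ⟨φ, hφ, hbdd, rfl, p, hp, q, hq, hpq⟩ := h.exists_psh
    obtain ⟨-, g, -, -, hr⟩ := isAutomorphism_affine L b
    refine ⟨fun z => φ (L z + b), hφ.comp_affine L.toLinearMap b,
      hbdd.mono (Set.range_comp_subset_range _ φ), rfl, g p, ?_, g q, ?_, ?_⟩
    · simpa [hr p] using hp
    · simpa [hr q] using hq
    · simpa [hr p, hr q] using hpq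

end Automorphism

section EuclideanNorm

variable {ι : Type*} [Fintype ι]

/-- The Euclidean norm of `ι → ℂ`, kept apart from the sup norm that Mathlib puts on this type. -/
noncomputable def eucNorm : Seminorm ℂ (ι → ℂ) :=
  (normSeminorm ℂ (EuclideanSpace ℂ ι)).comp (WithLp.linearEquiv 2 ℂ (ι → ℂ)).symm.toLinearMap

theorem eucNorm_sq (z : ι → ℂ) : eucNorm z ^ 2 = ∑ i, ‖z i‖ ^ 2 :=
  EuclideanSpace.norm_sq_eq (WithLp.toLp 2 z)

theorem continuous_eucNorm : Continuous (eucNorm : (ι → ℂ) → ℝ) :=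
  (PiLp.continuous_toLp 2 fun _ : ι => ℂ).norm

theorem norm_le_eucNorm (z : ι → ℂ) : ‖z‖ ≤ eucNorm z :=
  (pi_norm_le_iff_of_nonneg (apply_nonneg eucNorm z)).mpr
    (PiLp.norm_apply_le (WithLp.toLp 2 z : EuclideanSpace ℂ ι))

theorem eucNorm_le_of_norm_le {c : ℝ} (hc : 0 ≤ c) {z w : ι → ℂ}
    (h : ∀ i, ‖w i‖ ≤ c * ‖z i‖) : eucNorm w ≤ c * eucNorm z := by
  refine (sq_le_sq₀ (apply_nonneg _ w) (mul_nonneg hc (apply_nonneg _ z))).mp ?_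
  rw [mul_pow, eucNorm_sq, eucNorm_sq, Finset.mul_sum]
  gcongr with i
  rw [← mul_pow]
  exact pow_le_pow_left₀ (norm_nonneg _) (h i) 2

theorem eucNorm_comp_equiv (σ : Equiv.Perm ι) (z : ι → ℂ) : eucNorm (z ∘ σ) = eucNorm z := by
  rw [← sq_eq_sq₀ (apply_nonneg _ _) (apply_nonneg _ _), eucNorm_sq, eucNorm_sq]
  exact Equiv.sum_comp σ fun i => ‖z i‖ ^ 2

theorem eucNorm_single [DecidableEq ι] (i : ι) (x : ℂ) : eucNorm (Pi.single i x) = ‖x‖ :=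
  PiLp.norm_single 2 (fun _ : ι => ℂ) i x

theorem isOpen_ball_eucNorm (r : ℝ) : IsOpen ((eucNorm : Seminorm ℂ (ι → ℂ)).ball 0 r) := by
  rw [Seminorm.ball_zero_eq]
  exact isOpen_lt continuous_eucNorm continuous_const

theorem isConnected_ball_eucNorm {r : ℝ} (hr : 0 < r) :
    IsConnected ((eucNorm : Seminorm ℂ (ι → ℂ)).ball 0 r) :=
  ⟨⟨0, eucNorm.mem_ball_self hr⟩, (eucNorm.convex_ball 0 r).isPreconnected⟩

theorem unitBall_eq_ball (k : ℕ) : unitBall k = eucNorm.ball 0 1 := by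
  ext z
  rw [Seminorm.mem_ball_zero, ← sq_lt_one_iff₀ (apply_nonneg _ z), eucNorm_sq]
  rfl

theorem biholomorphic_ball_unitBall {k : ℕ} {r : ℝ} (hr : 0 < r) :
    Biholomorphic (eucNorm.ball 0 r) (unitBall k) := by
  have hr' : (r : ℂ) ≠ 0 := by exact_mod_cast hr.ne'
  refine ⟨fun z => (r : ℂ)⁻¹ • z, fun w => (r : ℂ) • w, by fun_prop, by fun_prop,
    fun z hz => ?_, fun w hw => ?_, fun z _ => smul_inv_smul₀ hr' z,
    fun w _ => inv_smul_smul₀ hr' w⟩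
  · rw [Seminorm.mem_ball_zero] at hz
    rw [unitBall_eq_ball, Seminorm.mem_ball_zero, map_smul_eq_mul, norm_inv, Complex.norm_real,
      Real.norm_of_nonneg hr.le]
    exact (inv_mul_lt_one₀ hr).mpr hz
  · rw [unitBall_eq_ball, Seminorm.mem_ball_zero] at hw
    rw [Seminorm.mem_ball_zero, map_smul_eq_mul, Complex.norm_real, Real.norm_of_nonneg hr.le]
    exact mul_lt_of_lt_one_right hr hw

end EuclideanNorm

section Basin

theorem norm_fderiv_apply_le_of_forall_norm_eq {E G : Type*} [NormedAddCommGroup E]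
    [NormedSpace ℂ E] [NormedAddCommGroup G] [NormedSpace ℂ G] {f : E → G}
    (hf : Differentiable ℂ f) {p ξ : E} {C δ : ℝ} (hδ : 0 < δ)
    (hC : ∀ ζ : ℂ, ‖ζ‖ = δ → ‖f (p + ζ • ξ)‖ ≤ C) : ‖fderiv ℂ f p ξ‖ ≤ C / δ := by
  have hline : HasDerivAt (fun ζ : ℂ => p + ζ • ξ) ξ 0 := by
    simpa using ((hasDerivAt_id (0 : ℂ)).smul_const ξ).const_add p
  have hfp : HasFDerivAt f (fderiv ℂ f p) (p + (0 : ℂ) • ξ) := by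
    simpa using (hf p).hasFDerivAt
  have hcomp : Differentiable ℂ fun ζ : ℂ => f (p + ζ • ξ) := by fun_prop
  rw [← (hfp.comp_hasDerivAt 0 hline).deriv]
  exact Complex.norm_deriv_le_of_forall_mem_sphere_norm_le hδ hcomp.diffContOnCl
    fun ζ hζ => hC ζ (mem_sphere_zero_iff_norm.mp hζ)

variable {k : ℕ}

/-- `F` is a sequence of automorphisms fixing the origin which, from the index `N` on, contract
the Euclidean ball of radius `r` by the factor `c`. -/
structure IsAttracting (F : ℕ → (Fin k → ℂ) → (Fin k → ℂ)) (r c : ℝ) (N : ℕ) : Prop where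
  isAutomorphism : ∀ n, IsAutomorphism (F n)
  map_zero : ∀ n, F n 0 = 0
  pos : 0 < r
  nonneg : 0 ≤ c
  lt_one : c < 1
  eucNorm_le : ∀ n, N ≤ n → ∀ z ∈ eucNorm.ball 0 r, eucNorm (F n z) ≤ c * eucNorm z

namespace IsAttracting

variable {F : ℕ → (Fin k → ℂ) → (Fin k → ℂ)} {r c : ℝ} {N n : ℕ} {z : Fin k → ℂ}

theorem mapsTo_ball (hF : IsAttracting F r c N) (hn : N ≤ n) :
    Set.MapsTo (F n) (eucNorm.ball 0 r) (eucNorm.ball 0 r) := fun z hz => by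
  rw [Seminorm.mem_ball_zero]
  exact ((hF.eucNorm_le n hn z hz).trans
    (mul_le_of_le_one_left (apply_nonneg _ _) hF.lt_one.le)).trans_lt (eucNorm.mem_ball_zero.mp hz)

theorem iterSeq_mem_ball (hF : IsAttracting F r c N) (hn : N ≤ n)
    (hz : iterSeq F n z ∈ eucNorm.ball 0 r) (j : ℕ) :
    iterSeq F (n + j) z ∈ eucNorm.ball 0 r := by
  induction j with
  | zero => exact hz
  | succ j ih => exact hF.mapsTo_ball (by lia) ih

theorem eucNorm_iterSeq_le (hF : IsAttracting F r c N) (hn : N ≤ n)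
    (hz : iterSeq F n z ∈ eucNorm.ball 0 r) (j : ℕ) :
    eucNorm (iterSeq F (n + j) z) ≤ c ^ j * eucNorm (iterSeq F n z) := by
  induction j with
  | zero => simp
  | succ j ih =>
    calc eucNorm (iterSeq F (n + (j + 1)) z) ≤ c * eucNorm (iterSeq F (n + j) z) :=
          hF.eucNorm_le (n + j + 1) (by lia) _ (hF.iterSeq_mem_ball hn hz j)
      _ ≤ c * (c ^ j * eucNorm (iterSeq F n z)) := mul_le_mul_of_nonneg_left ih hF.nonneg
      _ = c ^ (j + 1) * eucNorm (iterSeq F n z) := by rw [pow_succ', mul_assoc]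

theorem tendsto_pow_mul (hF : IsAttracting F r c N) (C : ℝ) :
    Filter.Tendsto (fun j : ℕ => c ^ j * C) Filter.atTop (𝓝 0) := by
  simpa using (tendsto_pow_atTop_nhds_zero_of_lt_one hF.nonneg hF.lt_one).mul_const C

theorem mem_basin (hF : IsAttracting F r c N) (hn : N ≤ n)
    (hz : iterSeq F n z ∈ eucNorm.ball 0 r) : z ∈ basin F := by
  refine (Filter.tendsto_add_atTop_iff_nat n).mp (squeeze_zero_norm (fun j => ?_)
    (hF.tendsto_pow_mul (eucNorm (iterSeq F n z))))
  rw [add_comm j n]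
  exact (norm_le_eucNorm _).trans (hF.eucNorm_iterSeq_le hn hz j)

theorem zero_mem_basin (hF : IsAttracting F r c N) : (0 : Fin k → ℂ) ∈ basin F := by
  simp [basin, iterSeq_apply_fixed hF.map_zero]

theorem eventually_mem_ball (hF : IsAttracting F r c N) (hz : z ∈ basin F) :
    ∀ᶠ n in Filter.atTop, iterSeq F n z ∈ eucNorm.ball 0 r :=
  Filter.Tendsto.eventually_mem hz
    ((isOpen_ball_eucNorm r).mem_nhds (eucNorm.mem_ball_self hF.pos))

theorem basin_eq_iUnion (hF : IsAttracting F r c N) :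
    basin F = ⋃ j, iterSeq F (N + j) ⁻¹' eucNorm.ball 0 r := by
  ext z
  refine ⟨fun hz => ?_, fun hz => ?_⟩
  · obtain ⟨n, hn, hNn⟩ :=
      ((hF.eventually_mem_ball hz).and (Filter.eventually_ge_atTop N)).exists
    exact Set.mem_iUnion.mpr ⟨n - N, by rwa [Nat.add_sub_cancel' hNn]⟩
  · obtain ⟨j, hj⟩ := Set.mem_iUnion.mp hz
    exact hF.mem_basin (Nat.le_add_right N j) hj

theorem isOpen_preimage_ball (hF : IsAttracting F r c N) (n : ℕ) :
    IsOpen (iterSeq F n ⁻¹' eucNorm.ball 0 r) :=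
  (isOpen_ball_eucNorm r).preimage (IsAutomorphism.iterSeq hF.isAutomorphism n).1.continuous

theorem isOpen_basin (hF : IsAttracting F r c N) : IsOpen (basin F) := by
  rw [hF.basin_eq_iUnion]
  exact isOpen_iUnion fun j => hF.isOpen_preimage_ball _

theorem isConnected_basin (hF : IsAttracting F r c N) : IsConnected (basin F) := by
  have hball (j : ℕ) : IsConnected (iterSeq F (N + j) ⁻¹' eucNorm.ball 0 r) :=
    (IsAutomorphism.iterSeq hF.isAutomorphism _).isConnected_preimage
      (isConnected_ball_eucNorm hF.pos)
  have h0 : ∀ j, (0 : Fin k → ℂ) ∈ iterSeq F (N + j) ⁻¹' eucNorm.ball 0 r := fun j => by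
    rw [Set.mem_preimage, iterSeq_apply_fixed hF.map_zero]
    exact eucNorm.mem_ball_self hF.pos
  rw [hF.basin_eq_iUnion]
  exact ⟨⟨0, Set.mem_iUnion.mpr ⟨0, h0 0⟩⟩,
    isPreconnected_iUnion ⟨0, Set.mem_iInter.mpr h0⟩ fun j => (hball j).isPreconnected⟩

theorem exists_exhaustion (hF : IsAttracting F r c N) : ∃ U : ℕ → Set (Fin k → ℂ),
    (∀ j, IsOpen (U j) ∧ U j ⊆ U (j + 1) ∧ Biholomorphic (U j) (unitBall k)) ∧
      basin F = ⋃ j, U j :=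
  ⟨fun j => iterSeq F (N + j) ⁻¹' eucNorm.ball 0 r, fun j => ⟨hF.isOpen_preimage_ball _,
    fun _ hz => hF.iterSeq_mem_ball (Nat.le_add_right N j) hz 1,
    (biholomorphic_ball_unitBall hF.pos).preimage (IsAutomorphism.iterSeq hF.isAutomorphism _)⟩,
    hF.basin_eq_iUnion⟩

theorem tendsto_fderiv_iterSeq (hF : IsAttracting F r c N) (hz : z ∈ basin F) (ξ : Fin k → ℂ) :
    Filter.Tendsto (fun n => fderiv ℂ (iterSeq F n) z ξ) Filter.atTop (𝓝 0) := by
  obtain ⟨n, hn, hNn⟩ := ((hF.eventually_mem_ball hz).and (Filter.eventually_ge_atTop N)).exists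
  have hline : Filter.Tendsto (fun ζ : ℂ => z + ζ • ξ) (𝓝 0) (𝓝 z) := by
    have : Continuous fun ζ : ℂ => z + ζ • ξ := by fun_prop
    simpa using this.tendsto 0
  obtain ⟨δ, hδ, hball⟩ := Metric.eventually_nhds_iff_ball.mp
    (hline.eventually_mem ((hF.isOpen_preimage_ball n).mem_nhds hn))
  refine (Filter.tendsto_add_atTop_iff_nat n).mp
    (squeeze_zero_norm (fun j => ?_) (hF.tendsto_pow_mul (r / (δ / 2))))
  rw [← mul_div_assoc, add_comm j n]
  refine norm_fderiv_apply_le_of_forall_norm_eq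
    (IsAutomorphism.iterSeq hF.isAutomorphism (n + j)).1 (half_pos hδ) fun ζ hζ => ?_
  have hmem : iterSeq F n (z + ζ • ξ) ∈ eucNorm.ball 0 r :=
    hball ζ (mem_ball_zero_iff.mpr (hζ.trans_lt (half_lt_self hδ)))
  calc ‖iterSeq F (n + j) (z + ζ • ξ)‖ ≤ eucNorm (iterSeq F (n + j) (z + ζ • ξ)) :=
        norm_le_eucNorm _
    _ ≤ c ^ j * eucNorm (iterSeq F n (z + ζ • ξ)) := hF.eucNorm_iterSeq_le hNn hmem j
    _ ≤ c ^ j * r := mul_le_mul_of_nonneg_left (eucNorm.mem_ball_zero.mp hmem).le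
        (pow_nonneg hF.nonneg j)

theorem kobayashiMetric_basin_eq_zero (hF : IsAttracting F r c N) (hz : z ∈ basin F)
    (ξ : Fin k → ℂ) : kobayashiMetric (basin F) z ξ = 0 := by
  refine le_antisymm (ENNReal.le_of_forall_pos_le_add fun ε hε _ => ?_) zero_le
  have hε' : ((ε : ℝ) : ℂ) ≠ 0 := by exact_mod_cast hε.ne'
  let v : ℕ → Fin k → ℂ := fun n => ((ε : ℝ) : ℂ)⁻¹ • fderiv ℂ (iterSeq F n) z ξ
  have hlim : Filter.Tendsto (fun n => eucNorm (iterSeq F n z) + eucNorm (v n))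
      Filter.atTop (𝓝 0) := by
    have hv : Filter.Tendsto v Filter.atTop (𝓝 0) := by
      simpa using (hF.tendsto_fderiv_iterSeq hz ξ).const_smul ((ε : ℝ) : ℂ)⁻¹
    have h0 := continuous_eucNorm.tendsto (0 : Fin k → ℂ)
    simpa using (h0.comp hz).add (h0.comp hv)
  obtain ⟨n, hn, hNn⟩ :=
    ((hlim.eventually_lt_const hF.pos).and (Filter.eventually_ge_atTop N)).exists
  have hdisc (ζ : ℂ) (hζ : ‖ζ‖ < 1) : iterSeq F n z + ζ • v n ∈ eucNorm.ball 0 r := by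
    rw [Seminorm.mem_ball_zero]
    refine (map_add_le_add eucNorm _ _).trans_lt (hn.trans_le' ?_)
    rw [map_smul_eq_mul]
    gcongr
    exact mul_le_of_le_one_left (apply_nonneg _ _) hζ.le
  calc kobayashiMetric (basin F) z ξ
      ≤ kobayashiMetric (iterSeq F n ⁻¹' eucNorm.ball 0 r) z ξ :=
        kobayashiMetric_anti (hF.isOpen_preimage_ball n) (fun _ hw => hF.mem_basin hNn hw) z ξ
    _ ≤ kobayashiMetric (eucNorm.ball 0 r) (iterSeq F n z) (fderiv ℂ (iterSeq F n) z ξ) :=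
        (IsAutomorphism.iterSeq hF.isAutomorphism n).kobayashiMetric_preimage_le
          (isOpen_ball_eucNorm r) z ξ
    _ ≤ ε := by simpa only [v, smul_inv_smul₀ hε'] using kobayashiMetric_smul_le hε hdisc
    _ = 0 + ε := (zero_add _).symm

end IsAttracting

end Basin

section ShiftMap

variable {k d : ℕ}

theorem tendsto_pow_pow_atTop_nhds_zero {a : ℝ} (hd : 2 ≤ d) (ha : 0 ≤ a) (ha1 : a < 1) :
    Filter.Tendsto (fun n : ℕ => a ^ d ^ n) Filter.atTop (𝓝 0) :=
  (tendsto_pow_atTop_nhds_zero_of_lt_one ha ha1).comp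
    (pow_right_strictMono₀ (by lia)).tendsto_atTop

theorem differentiable_shiftMap (η : ℂ) : Differentiable ℂ (shiftMap k d η) := by
  refine differentiable_pi.mpr fun i => Differentiable.add ?_ (by fun_prop)
  split_ifs <;> fun_prop

theorem shiftMap_zero (hd : d ≠ 0) (η : ℂ) : shiftMap k d η 0 = 0 := by
  ext i
  simp [shiftMap, hd]

theorem shiftMap_apply_zero {n : ℕ} (η : ℂ) (z : Fin (n + 1) → ℂ) :
    shiftMap (n + 1) d η z 0 = η * z (Fin.last n) := by
  have h : (finRotate (n + 1)).symm 0 = Fin.last n :=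
    (Equiv.symm_apply_eq _).mpr finRotate_last.symm
  simp only [shiftMap, h, Fin.val_zero, if_true, zero_add]

theorem shiftMap_apply_succ {n : ℕ} (η : ℂ) (z : Fin (n + 1) → ℂ) (j : Fin n) :
    shiftMap (n + 1) d η z j.succ = z j.succ ^ d + η * z j.castSucc := by
  have h : (finRotate (n + 1)).symm j.succ = j.castSucc := by
    rw [Equiv.symm_apply_eq, finRotate_apply, Fin.coeSucc_eq_succ]
  simp only [shiftMap, h, Fin.val_succ, Nat.succ_ne_zero, if_false]

/-- The inverse of `shiftMap`: the coordinates are recovered one by one, from the last to the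
first. -/
noncomputable def shiftMapInv {n : ℕ} (d : ℕ) (η : ℂ) (w : Fin (n + 1) → ℂ) : Fin (n + 1) → ℂ :=
  Fin.reverseInduction (η⁻¹ * w 0) fun j x => η⁻¹ * (w j.succ - x ^ d)

theorem shiftMapInv_last {n : ℕ} (η : ℂ) (w : Fin (n + 1) → ℂ) :
    shiftMapInv d η w (Fin.last n) = η⁻¹ * w 0 :=
  Fin.reverseInduction_last

theorem shiftMapInv_castSucc {n : ℕ} (η : ℂ) (w : Fin (n + 1) → ℂ) (j : Fin n) :
    shiftMapInv d η w j.castSucc = η⁻¹ * (w j.succ - shiftMapInv d η w j.succ ^ d) :=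
  Fin.reverseInduction_castSucc _

theorem differentiable_shiftMapInv {n : ℕ} (η : ℂ) :
    Differentiable ℂ (shiftMapInv (n := n) d η) := by
  refine differentiable_pi.mpr fun i => ?_
  induction i using Fin.reverseInduction with
  | last => simp only [shiftMapInv_last]; fun_prop
  | cast j ih => simp only [shiftMapInv_castSucc]; fun_prop

theorem isAutomorphism_shiftMap {n : ℕ} {η : ℂ} (hη : η ≠ 0) :
    IsAutomorphism (shiftMap (n + 1) d η) := by
  refine ⟨differentiable_shiftMap η, shiftMapInv d η, differentiable_shiftMapInv η,
    fun z => funext fun i => ?_, fun w => funext fun i => ?_⟩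
  · induction i using Fin.reverseInduction with
    | last => rw [shiftMapInv_last, shiftMap_apply_zero, inv_mul_cancel_left₀ hη]
    | cast j ih =>
      rw [shiftMapInv_castSucc, ih, shiftMap_apply_succ, add_sub_cancel_left,
        inv_mul_cancel_left₀ hη]
  · cases i using Fin.cases with
    | zero => rw [shiftMap_apply_zero, shiftMapInv_last, mul_inv_cancel_left₀ hη]
    | succ j =>
      rw [shiftMap_apply_succ, shiftMapInv_castSucc, mul_inv_cancel_left₀ hη, add_sub_cancel]

theorem norm_shiftMap_le (η : ℂ) (z : Fin k → ℂ) :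
    ‖shiftMap k d η z‖ ≤ ‖z‖ ^ d + ‖η‖ * ‖z‖ := by
  refine (pi_norm_le_iff_of_nonneg (by positivity)).mpr fun i => (norm_add_le _ _).trans ?_
  rw [norm_mul]
  gcongr
  · split_ifs
    · rw [norm_zero]; positivity
    · rw [norm_pow]
      gcongr
      exact norm_le_pi_norm z i
  · exact norm_le_pi_norm z _

theorem norm_shiftMap_le_of_norm_le {η : ℕ → ℂ} {a : ℝ} (hη : ∀ n, ‖η n‖ ≤ a ^ d ^ n) (n : ℕ)
    (z : Fin k → ℂ) : ‖shiftMap k d (η n) z‖ ≤ ‖z‖ ^ d + a ^ d ^ n * ‖z‖ :=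
  (norm_shiftMap_le _ z).trans (by gcongr; exact hη n)

theorem norm_shiftMap_apply_ge (η : ℂ) (z : Fin k → ℂ) {i : Fin k} (hi : i.val ≠ 0) :
    ‖z i‖ ^ d - ‖η‖ * ‖z‖ ≤ ‖shiftMap k d η z i‖ :=
  calc ‖z i‖ ^ d - ‖η‖ * ‖z‖ ≤ ‖z i ^ d‖ - ‖η * z ((finRotate k).symm i)‖ := by
        rw [norm_pow, norm_mul]
        gcongr
        exact norm_le_pi_norm z _
    _ ≤ ‖z i ^ d + η * z ((finRotate k).symm i)‖ := norm_sub_le_norm_add _ _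
    _ = ‖shiftMap k d η z i‖ := by simp only [shiftMap, if_neg hi]

theorem eucNorm_shiftMap_le (hd : 2 ≤ d) (η : ℂ) {z : Fin k → ℂ} {r : ℝ} (hr : r ≤ 1)
    (hz : z ∈ eucNorm.ball 0 r) : eucNorm (shiftMap k d η z) ≤ (r + ‖η‖) * eucNorm z := by
  have hz' : ∀ i, ‖z i‖ ≤ r := fun i =>
    ((norm_le_pi_norm z i).trans (norm_le_eucNorm z)).trans (eucNorm.mem_ball_zero.mp hz).le
  have hr0 : 0 ≤ r := (apply_nonneg eucNorm z).trans (eucNorm.mem_ball_zero.mp hz).le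
  have hpow : eucNorm (fun i : Fin k => if i.val = 0 then 0 else z i ^ d) ≤ r * eucNorm z := by
    refine eucNorm_le_of_norm_le hr0 fun i => ?_
    split_ifs
    · rw [norm_zero]; positivity
    · calc ‖z i ^ d‖ ≤ ‖z i‖ ^ 2 := by
            rw [norm_pow]
            exact pow_le_pow_of_le_one (norm_nonneg _) ((hz' i).trans hr) hd
        _ ≤ r * ‖z i‖ := by rw [sq]; gcongr; exact hz' i
  calc eucNorm (shiftMap k d η z) ≤ eucNorm (fun i : Fin k => if i.val = 0 then 0 else z i ^ d) +
        eucNorm (η • (z ∘ (finRotate k).symm)) := map_add_le_add eucNorm _ _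
    _ ≤ r * eucNorm z + ‖η‖ * eucNorm z := by
      rw [map_smul_eq_mul, eucNorm_comp_equiv]
      gcongr
    _ = (r + ‖η‖) * eucNorm z := by ring

theorem isAttracting_shiftMap {n N : ℕ} (hd : 2 ≤ d) {η : ℕ → ℂ} (hη : ∀ m, η m ≠ 0)
    (hN : ∀ m, N ≤ m → ‖η m‖ ≤ 1 / 4) :
    IsAttracting (fun m => shiftMap (n + 1) d (η m)) (1 / 2) (3 / 4) N where
  isAutomorphism m := isAutomorphism_shiftMap (hη m)
  map_zero m := shiftMap_zero (by lia) (η m)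
  pos := by norm_num
  nonneg := by norm_num
  lt_one := by norm_num
  eucNorm_le m hm z hz := (eucNorm_shiftMap_le hd (η m) (by norm_num) hz).trans
    (mul_le_mul_of_nonneg_right (by linarith [hN m hm]) (apply_nonneg _ z))

theorem exists_isAttracting_shiftMap {n : ℕ} (hd : 2 ≤ d) {η : ℕ → ℂ} {a : ℝ} (ha : 0 ≤ a)
    (ha1 : a < 1) (hη0 : ∀ m, η m ≠ 0) (hη : ∀ m, ‖η m‖ ≤ a ^ d ^ m) :
    ∃ N, IsAttracting (fun m => shiftMap (n + 1) d (η m)) (1 / 2) (3 / 4) N := by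
  obtain ⟨N, hN⟩ := Filter.eventually_atTop.mp
    ((tendsto_pow_pow_atTop_nhds_zero hd ha ha1).eventually_le_const
      (show (0 : ℝ) < 1 / 4 by norm_num))
  exact ⟨N, isAttracting_shiftMap hd hη0 fun m hm => (hη m).trans (hN m hm)⟩

theorem shiftMap_mem_Vplus (hd : 2 ≤ d) {η : ℂ} {R : ℝ} (hη : ‖η‖ ≤ 1) (hR : 1 + ‖η‖ ≤ R)
    {z : Fin k → ℂ} (hz : z ∈ Vplus k R) : shiftMap k d η z ∈ Vplus k R := by
  obtain ⟨i, hi, hzi, hRi⟩ := hz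
  rw [← hzi] at hRi
  have hgrow : ‖z‖ ≤ ‖shiftMap k d η z i‖ := by
    have hsq : ‖z‖ ^ 2 ≤ ‖z‖ ^ d :=
      pow_le_pow_right₀ (by linarith [norm_nonneg η]) hd
    calc ‖z‖ = 1 * ‖z‖ := (one_mul _).symm
      _ ≤ (‖z‖ - ‖η‖) * ‖z‖ := by gcongr; linarith
      _ = ‖z‖ ^ 2 - ‖η‖ * ‖z‖ := by ring
      _ ≤ ‖z i‖ ^ d - ‖η‖ * ‖z‖ := by rw [← hzi]; gcongr
      _ ≤ ‖shiftMap k d η z i‖ := norm_shiftMap_apply_ge η z hi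
  refine mem_Vplus_of_norm_le hi (hRi.trans hgrow) fun j hj => ?_
  calc ‖shiftMap k d η z j‖ = ‖η‖ * ‖z ((finRotate k).symm j)‖ := by simp [shiftMap, hj]
    _ ≤ 1 * ‖z‖ := by gcongr; exact norm_le_pi_norm z _
    _ = ‖z‖ := one_mul _
    _ ≤ ‖shiftMap k d η z i‖ := hgrow

theorem iterSeq_mem_of_mapsTo {X : Type*} {F : ℕ → X → X} {S : Set X}
    (hF : ∀ n, Set.MapsTo (F n) S S) {x : X} (hx : x ∈ S) : ∀ n, iterSeq F n x ∈ S
  | 0 => hF 0 hx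
  | n + 1 => hF (n + 1) (iterSeq_mem_of_mapsTo hF hx n)

theorem disjoint_basin_shiftMap_Vplus (hd : 2 ≤ d) {η : ℕ → ℂ} {R : ℝ} (hη : ∀ n, ‖η n‖ ≤ 1)
    (hR : ∀ n, 1 + ‖η n‖ ≤ R) :
    Disjoint (basin fun n => shiftMap k d (η n)) (Vplus k R) := by
  refine Set.disjoint_left.mpr fun z hz hzV => ?_
  have hR0 : 0 < R := by linarith [hR 0, norm_nonneg (η 0)]
  obtain ⟨n, hn⟩ :=
    ((tendsto_zero_iff_norm_tendsto_zero.mp hz).eventually_lt_const hR0).exists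
  obtain ⟨i, -, hi, hRi⟩ :=
    iterSeq_mem_of_mapsTo (fun n _ => shiftMap_mem_Vplus hd (hη n) (hR n)) hzV n
  linarith

theorem two_mul_pow_le_norm_iterSeq_shiftMap (hd : 2 ≤ d) {η : ℕ → ℂ} {a : ℝ} (ha : 0 < a)
    (hη : ∀ n, ‖η n‖ ≤ a ^ d ^ n) {i : Fin k} (hi : i.val ≠ 0) {m : ℕ} {z : Fin k → ℂ}
    (hbdd : ∀ j, ‖iterSeq (fun n => shiftMap k d (η n)) (m + j) z‖ ≤ 1)
    (hz : 4 * a ^ d ^ m ≤ ‖iterSeq (fun n => shiftMap k d (η n)) m z i‖) (j : ℕ) :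
    2 * (2 * a ^ d ^ m) ^ d ^ j ≤ ‖iterSeq (fun n => shiftMap k d (η n)) (m + j) z i‖ := by
  set Φ := iterSeq fun n => shiftMap k d (η n)
  induction j with
  | zero =>
    rw [pow_zero, pow_one, add_zero]
    linarith
  | succ j ih =>
    set t := (2 * a ^ d ^ m) ^ d ^ j
    have htpow : (2 * a ^ d ^ m) ^ d ^ (j + 1) = t ^ d := by rw [pow_succ d j, pow_mul]
    have hηt : ‖η (m + (j + 1))‖ ≤ t ^ d := by
      rw [← htpow]
      refine (hη _).trans ?_
      rw [pow_add, pow_mul]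
      gcongr
      linarith [show 0 < a ^ d ^ m by positivity]
    have h4 : (4 : ℝ) ≤ 2 ^ d := by
      calc (4 : ℝ) = 2 ^ 2 := by norm_num
        _ ≤ 2 ^ d := pow_le_pow_right₀ one_le_two hd
    have ht : 0 < t ^ d := by positivity
    calc 2 * (2 * a ^ d ^ m) ^ d ^ (j + 1) ≤ 2 ^ d * t ^ d - t ^ d * 1 := by
          rw [htpow]
          nlinarith
      _ ≤ ‖Φ (m + j) z i‖ ^ d - ‖η (m + (j + 1))‖ * ‖Φ (m + j) z‖ := by
          rw [← mul_pow]
          gcongr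
          exact hbdd j
      _ ≤ ‖Φ (m + (j + 1)) z i‖ := norm_shiftMap_apply_ge _ _ hi

end ShiftMap

section Potential

open Real

variable {k d m n : ℕ} {a : ℝ} {F : ℕ → (Fin k → ℂ) → (Fin k → ℂ)}

/-- The norm of `F(n) z`, cut off below at `a ^ d ^ n`. The factor `2` makes
`potentialSeq` decreasing in `n`. -/
noncomputable def cutoffNorm (F : ℕ → (Fin k → ℂ) → (Fin k → ℂ)) (d : ℕ) (a : ℝ) (n : ℕ)
    (z : Fin k → ℂ) : ℝ :=
  2 * max (a ^ d ^ n) ‖iterSeq F n z‖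

/-- The approximants `d⁻ⁿ log (cutoffNorm F d a n z)` of `potential`. -/
noncomputable def potentialSeq (F : ℕ → (Fin k → ℂ) → (Fin k → ℂ)) (d : ℕ) (a : ℝ) (n : ℕ)
    (z : Fin k → ℂ) : ℝ :=
  ((d : ℝ) ^ n)⁻¹ * log (cutoffNorm F d a n z)

/-- The rate at which the orbit of `z` approaches the origin or escapes, measured on the scale
`d ^ n`; the basin of `F` is the set where it is negative. -/
noncomputable def potential (F : ℕ → (Fin k → ℂ) → (Fin k → ℂ)) (d : ℕ) (a : ℝ)
    (z : Fin k → ℂ) : ℝ :=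
  ⨅ n, potentialSeq F d a n z

theorem cutoffNorm_pos (ha : 0 < a) (n : ℕ) (z : Fin k → ℂ) : 0 < cutoffNorm F d a n z :=
  mul_pos two_pos (lt_max_of_lt_left (by positivity))

theorem norm_iterSeq_le_cutoffNorm (n : ℕ) (z : Fin k → ℂ) :
    ‖iterSeq F n z‖ ≤ cutoffNorm F d a n z :=
  (le_max_right _ _).trans (le_mul_of_one_le_left ((norm_nonneg _).trans (le_max_right _ _))
    one_le_two)

theorem cutoffNorm_succ_le (hd : 2 ≤ d) (ha : 0 < a) (ha1 : a ≤ 1)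
    (hF : ∀ n z, ‖F n z‖ ≤ ‖z‖ ^ d + a ^ d ^ n * ‖z‖) (n : ℕ) (z : Fin k → ℂ) :
    cutoffNorm F d a (n + 1) z ≤ cutoffNorm F d a n z ^ d := by
  have hs : 0 < a ^ d ^ n := by positivity
  have hpow : a ^ d ^ (n + 1) = (a ^ d ^ n) ^ d := by rw [pow_succ, pow_mul]
  set s := a ^ d ^ n
  set M := max s ‖iterSeq F n z‖
  have hsM : s ≤ M := le_max_left _ _
  have hM : ‖iterSeq F n z‖ ≤ M := le_max_right _ _
  have hlin : s ^ d * M ≤ M ^ d :=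
    calc s ^ d * M ≤ s ^ (d - 1) * M := by
          gcongr ?_ * M
          exact pow_le_pow_of_le_one hs.le (pow_le_one₀ ha.le ha1) (Nat.sub_le d 1)
      _ ≤ M ^ (d - 1) * M := by gcongr
      _ = M ^ d := pow_sub_one_mul (by lia) M
  have hstep : ‖iterSeq F (n + 1) z‖ ≤ 2 * M ^ d :=
    calc ‖iterSeq F (n + 1) z‖
        ≤ ‖iterSeq F n z‖ ^ d + a ^ d ^ (n + 1) * ‖iterSeq F n z‖ := hF (n + 1) _
      _ ≤ M ^ d + s ^ d * M := by rw [hpow]; gcongr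
      _ ≤ 2 * M ^ d := by linarith
  calc cutoffNorm F d a (n + 1) z ≤ 2 * (2 * M ^ d) := by
        refine mul_le_mul_of_nonneg_left (max_le ?_ hstep) two_pos.le
        rw [hpow]
        exact (pow_le_pow_left₀ hs.le hsM d).trans
          (le_mul_of_one_le_left (by positivity) one_le_two)
    _ = 2 ^ 2 * M ^ d := by ring
    _ ≤ 2 ^ d * M ^ d := by gcongr; exact one_le_two
    _ = cutoffNorm F d a n z ^ d := (mul_pow 2 M d).symm

theorem antitone_potentialSeq (hd : 2 ≤ d) (ha : 0 < a) (ha1 : a ≤ 1)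
    (hF : ∀ n z, ‖F n z‖ ≤ ‖z‖ ^ d + a ^ d ^ n * ‖z‖) : Antitone (potentialSeq F d a) := by
  refine antitone_nat_of_succ_le fun n z => ?_
  have : (0 : ℝ) < d := by exact_mod_cast (by lia : 0 < d)
  calc potentialSeq F d a (n + 1) z
      ≤ ((d : ℝ) ^ (n + 1))⁻¹ * log (cutoffNorm F d a n z ^ d) := by
        refine mul_le_mul_of_nonneg_left ?_ (by positivity)
        exact log_le_log (cutoffNorm_pos ha _ z) (cutoffNorm_succ_le hd ha ha1 hF n z)
    _ = potentialSeq F d a n z := by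
        rw [log_pow, potentialSeq, pow_succ]
        field_simp

theorem le_potentialSeq_of_pow_le (hd : d ≠ 0) {t : ℝ} (ht : 0 < t) {j : ℕ} {z : Fin k → ℂ}
    (h : t ^ d ^ j ≤ cutoffNorm F d a (m + j) z) :
    ((d : ℝ) ^ m)⁻¹ * log t ≤ potentialSeq F d a (m + j) z := by
  have : (0 : ℝ) < d := by exact_mod_cast Nat.pos_of_ne_zero hd
  calc ((d : ℝ) ^ m)⁻¹ * log t = ((d : ℝ) ^ (m + j))⁻¹ * log (t ^ d ^ j) := by
        rw [log_pow, Nat.cast_pow, pow_add]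
        field_simp
    _ ≤ potentialSeq F d a (m + j) z :=
        mul_le_mul_of_nonneg_left (log_le_log (by positivity) h) (by positivity)

theorem log_le_potentialSeq (hd : d ≠ 0) (ha : 0 < a) (n : ℕ) (z : Fin k → ℂ) :
    log a ≤ potentialSeq F d a n z := by
  have h : a ^ d ^ n ≤ cutoffNorm F d a n z :=
    (le_max_left _ _).trans (le_mul_of_one_le_left (by positivity) one_le_two)
  simpa using le_potentialSeq_of_pow_le (m := 0) hd ha (by rwa [zero_add])

theorem bddBelow_range_potentialSeq (hd : d ≠ 0) (ha : 0 < a) (z : Fin k → ℂ) :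
    BddBelow (Set.range fun n => potentialSeq F d a n z) :=
  ⟨log a, Set.forall_mem_range.mpr fun n => log_le_potentialSeq hd ha n z⟩

theorem log_le_potential (hd : d ≠ 0) (ha : 0 < a) (z : Fin k → ℂ) :
    log a ≤ potential F d a z :=
  le_ciInf fun n => log_le_potentialSeq hd ha n z

theorem log_lt_potential_of_pow_le (hd : 2 ≤ d) (ha : 0 < a) (ha1 : a ≤ 1)
    (hF : ∀ n z, ‖F n z‖ ≤ ‖z‖ ^ d + a ^ d ^ n * ‖z‖) {t : ℝ} (ht : a ^ d ^ m < t) {z : Fin k → ℂ}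
    (h : ∀ j, t ^ d ^ j ≤ ‖iterSeq F (m + j) z‖) : log a < potential F d a z := by
  have : (0 : ℝ) < d := by exact_mod_cast (by lia : 0 < d)
  have hs : 0 < a ^ d ^ m := by positivity
  calc log a = ((d : ℝ) ^ m)⁻¹ * log (a ^ d ^ m) := by
        rw [log_pow, Nat.cast_pow, inv_mul_cancel_left₀ (by positivity)]
    _ < ((d : ℝ) ^ m)⁻¹ * log t :=
        mul_lt_mul_of_pos_left (log_lt_log hs ht) (by positivity)
    _ ≤ potential F d a z := le_ciInf fun j =>
        (le_potentialSeq_of_pow_le (by lia) (hs.trans ht)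
          ((h j).trans (norm_iterSeq_le_cutoffNorm _ z))).trans
        (antitone_potentialSeq hd ha ha1 hF (Nat.le_add_left j m) z)

theorem potentialSeq_eq_posLog (ha : 0 < a) (z : Fin k → ℂ) :
    potentialSeq F d a n z = ((d : ℝ) ^ n)⁻¹ *
      (log (2 * a ^ d ^ n) + log⁺ ‖(((a ^ d ^ n)⁻¹ : ℝ) : ℂ) • iterSeq F n z‖) := by
  have hs : 0 < a ^ d ^ n := by positivity
  rw [potentialSeq, cutoffNorm, norm_smul, Complex.norm_real, norm_of_nonneg (inv_nonneg.mpr hs.le),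
    posLog_eq_log_max_one (by positivity), ← log_mul (by positivity) (by positivity), mul_assoc,
    mul_max_of_nonneg _ _ hs.le, mul_one, mul_inv_cancel_left₀ hs.ne']

theorem isPlurisubharmonic_potentialSeq (ha : 0 < a) (hF : Differentiable ℂ (iterSeq F n)) :
    IsPlurisubharmonic (potentialSeq F d a n) := by
  rw [funext (potentialSeq_eq_posLog ha)]
  exact ((isPlurisubharmonic_posLog_norm (hF.const_smul (((a ^ d ^ n)⁻¹ : ℝ) : ℂ))).const_add
    _).const_mul (by positivity)

theorem isPlurisubharmonic_potential (hd : 2 ≤ d) (ha : 0 < a) (ha1 : a ≤ 1)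
    (hF : ∀ n z, ‖F n z‖ ≤ ‖z‖ ^ d + a ^ d ^ n * ‖z‖)
    (hdiff : ∀ n, Differentiable ℂ (iterSeq F n)) : IsPlurisubharmonic (potential F d a) :=
  isPlurisubharmonic_iInf (fun n => isPlurisubharmonic_potentialSeq ha (hdiff n))
    (antitone_potentialSeq hd ha ha1 hF) (log_le_potentialSeq (by lia) ha)

theorem tendsto_natCast_pow_atTop (hd : 2 ≤ d) :
    Filter.Tendsto (fun n => (d : ℝ) ^ n) Filter.atTop Filter.atTop :=
  tendsto_pow_atTop_atTop_of_one_lt (by exact_mod_cast (by lia : 1 < d))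

theorem cutoffNorm_eq_exp (hd : d ≠ 0) (ha : 0 < a) (z : Fin k → ℂ) :
    cutoffNorm F d a n z = exp ((d : ℝ) ^ n * potentialSeq F d a n z) := by
  have hd0 : (d : ℝ) ^ n ≠ 0 := by positivity
  rw [potentialSeq, mul_inv_cancel_left₀ hd0, exp_log (cutoffNorm_pos ha n z)]

theorem potential_neg_of_mem_basin (hd : 2 ≤ d) (ha : 0 < a) (ha1 : a < 1) {z : Fin k → ℂ}
    (hz : z ∈ basin F) : potential F d a z < 0 := by
  have hlim : Filter.Tendsto (fun n => cutoffNorm F d a n z) Filter.atTop (𝓝 0) := by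
    simpa [cutoffNorm] using ((tendsto_pow_pow_atTop_nhds_zero hd ha.le ha1).max
      (tendsto_zero_iff_norm_tendsto_zero.mp hz)).const_mul 2
  obtain ⟨n, hn⟩ := (hlim.eventually_lt_const zero_lt_one).exists
  have : (0 : ℝ) < d := by exact_mod_cast (by lia : 0 < d)
  exact (ciInf_le (bddBelow_range_potentialSeq (by lia) ha z) n).trans_lt
    (mul_neg_of_pos_of_neg (by positivity) (log_neg (cutoffNorm_pos ha n z) hn))

theorem mem_basin_of_potential_neg (hd : 2 ≤ d) (ha : 0 < a) (ha1 : a ≤ 1)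
    (hF : ∀ n z, ‖F n z‖ ≤ ‖z‖ ^ d + a ^ d ^ n * ‖z‖) {z : Fin k → ℂ}
    (hz : potential F d a z < 0) : z ∈ basin F := by
  obtain ⟨m, hm⟩ := exists_lt_of_ciInf_lt hz
  have hexp : Filter.Tendsto (fun n => exp ((d : ℝ) ^ n * potentialSeq F d a m z))
      Filter.atTop (𝓝 0) :=
    tendsto_exp_atBot.comp ((tendsto_natCast_pow_atTop hd).atTop_mul_const_of_neg hm)
  refine squeeze_zero_norm' ((Filter.eventually_ge_atTop m).mono fun n hn => ?_) hexp
  calc ‖iterSeq F n z‖ ≤ exp ((d : ℝ) ^ n * potentialSeq F d a n z) :=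
        (norm_iterSeq_le_cutoffNorm n z).trans_eq (cutoffNorm_eq_exp (by lia) ha z)
    _ ≤ exp ((d : ℝ) ^ n * potentialSeq F d a m z) := by
        gcongr
        exact antitone_potentialSeq hd ha ha1 hF hn z

theorem basin_eq_potential_neg (hd : 2 ≤ d) (ha : 0 < a) (ha1 : a < 1)
    (hF : ∀ n z, ‖F n z‖ ≤ ‖z‖ ^ d + a ^ d ^ n * ‖z‖) :
    basin F = {z | potential F d a z < 0} :=
  Set.Subset.antisymm (fun _ => potential_neg_of_mem_basin hd ha ha1)
    fun _ => mem_basin_of_potential_neg hd ha ha1.le hF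

theorem potential_zero (hd : 2 ≤ d) (ha : 0 < a) (hF : ∀ n, F n 0 = 0) :
    potential F d a 0 = log a := by
  refine le_antisymm ?_ (log_le_potential (by lia) ha 0)
  have hseq (n : ℕ) : potentialSeq F d a n 0 = ((d : ℝ) ^ n)⁻¹ * log 2 + log a := by
    have hd0 : (d : ℝ) ^ n ≠ 0 := pow_ne_zero n (by exact_mod_cast (by lia : d ≠ 0))
    rw [potentialSeq, cutoffNorm, iterSeq_apply_fixed hF, norm_zero,
      max_eq_left (by positivity), log_mul two_ne_zero (by positivity), log_pow, Nat.cast_pow,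
      mul_add, inv_mul_cancel_left₀ hd0]
  have hlim : Filter.Tendsto (fun n => potentialSeq F d a n 0) Filter.atTop (𝓝 (log a)) := by
    simpa [hseq] using
      ((tendsto_natCast_pow_atTop hd).inv_tendsto_atTop.mul_const (log 2)).add_const (log a)
  exact ge_of_tendsto' hlim (ciInf_le (bddBelow_range_potentialSeq (by lia) ha 0))

end Potential

section Main

variable {d n : ℕ} {a : ℝ} {η : ℕ → ℂ}

theorem exists_mem_basin_log_lt_potential (hd : 2 ≤ d) (ha : 0 < a) (ha1 : a < 1)
    (hη0 : ∀ m, η m ≠ 0) (hη : ∀ m, ‖η m‖ ≤ a ^ d ^ m) :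
    ∃ z ∈ basin (fun m => shiftMap (n + 2) d (η m)),
      Real.log a < potential (fun m => shiftMap (n + 2) d (η m)) d a z := by
  -- The orbit is made to pass through `4s • e`, where `e` is the basis vector of index `1` and
  -- `s = a ^ d ^ m` is small. From there on the linear term of `shiftMap` never cancels more than a
  -- quarter of the power in this coordinate, so the orbit decays more slowly than `a ^ d ^ n`.
  obtain ⟨N, hF⟩ := exists_isAttracting_shiftMap (n := n + 1) hd ha.le ha1 hη0 hη
  obtain ⟨m, hm, hNm⟩ := (((tendsto_pow_pow_atTop_nhds_zero hd ha.le ha1).eventually_lt_const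
    (show (0 : ℝ) < 1 / 8 by norm_num)).and (Filter.eventually_ge_atTop N)).exists
  have hs : 0 < a ^ d ^ m := by positivity
  have hnorm : ‖((4 * a ^ d ^ m : ℝ) : ℂ)‖ = 4 * a ^ d ^ m := by
    rw [Complex.norm_real, Real.norm_of_nonneg (by positivity)]
  obtain ⟨-, G, -, -, hG⟩ := IsAutomorphism.iterSeq hF.isAutomorphism m
  set q := G (Pi.single 1 ((4 * a ^ d ^ m : ℝ) : ℂ))
  have hq : iterSeq (fun m => shiftMap (n + 2) d (η m)) m q =
      Pi.single 1 ((4 * a ^ d ^ m : ℝ) : ℂ) := hG _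
  have hqB : iterSeq (fun m => shiftMap (n + 2) d (η m)) m q ∈ eucNorm.ball 0 (1 / 2) := by
    rw [hq, Seminorm.mem_ball_zero, eucNorm_single, hnorm]
    linarith
  have hbdd (j : ℕ) : ‖iterSeq (fun m => shiftMap (n + 2) d (η m)) (m + j) q‖ ≤ 1 :=
    (norm_le_eucNorm _).trans
      ((eucNorm.mem_ball_zero.mp (hF.iterSeq_mem_ball hNm hqB j)).le.trans (by norm_num))
  have hlow := two_mul_pow_le_norm_iterSeq_shiftMap hd ha hη (i := (1 : Fin (n + 2)))
    (by simp) hbdd (by rw [hq, Pi.single_eq_same, hnorm])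
  refine ⟨q, hF.mem_basin hNm hqB, log_lt_potential_of_pow_le hd ha ha1.le
    (norm_shiftMap_le_of_norm_le hη) (lt_two_mul_self hs) fun j => ?_⟩
  exact ((le_mul_of_one_le_left (by positivity) one_le_two).trans (hlow j)).trans
    (norm_le_pi_norm _ _)

theorem isShortCk_basin_shiftMap (hd : 2 ≤ d) (ha : 0 < a) (ha1 : a < 1)
    (hη0 : ∀ m, η m ≠ 0) (hη : ∀ m, ‖η m‖ ≤ a ^ d ^ m) :
    IsShortCk (basin fun m => shiftMap (n + 2) d (η m)) := by
  obtain ⟨N, hF⟩ := exists_isAttracting_shiftMap (n := n + 1) hd ha.le ha1 hη0 hη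
  have hbound := norm_shiftMap_le_of_norm_le (k := n + 2) hη
  obtain ⟨q, hq, hpos⟩ := exists_mem_basin_log_lt_potential (n := n) hd ha ha1 hη0 hη
  refine ⟨hF.isOpen_basin, hF.isConnected_basin, hF.exists_exhaustion,
    fun p hp ξ => hF.kobayashiMetric_basin_eq_zero hp ξ, potential _ d a,
    isPlurisubharmonic_potential hd ha ha1.le hbound
      fun m => (IsAutomorphism.iterSeq hF.isAutomorphism m).1,
    ⟨Real.log a, Set.forall_mem_range.mpr (log_le_potential (by lia) ha)⟩,
    basin_eq_potential_neg hd ha ha1 hbound, 0, hF.zero_mem_basin, q, hq, ?_⟩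
  rw [potential_zero hd ha hF.map_zero]
  exact hpos.ne

theorem exists_linearEquiv_mapsTo_Vplus {V : Set (Fin (n + 2) → ℂ)}
    (hV : 2 ≤ (MvPolynomial.vanishingIdeal ℂ V).height) :
    ∃ L : (Fin (n + 2) → ℂ) ≃ₗ[ℂ] (Fin (n + 2) → ℂ), ∀ R : ℝ, 1 < R →
      Set.MapsTo (fun z => translate (n + 2) R (L z)) V (Vplus (n + 2) R) := by
  obtain ⟨L, hL⟩ := exists_linearEquiv_norm_le hV one_half_pos
  exact ⟨L, fun R hR z hz => translate_mem_Vplus hR (hL z hz).1 (hL z hz).2⟩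

theorem IsShortCk.preimage_translate {k : ℕ} {Ω : Set (Fin k → ℂ)} (h : IsShortCk Ω)
    (L : (Fin k → ℂ) ≃ₗ[ℂ] (Fin k → ℂ)) (R : ℝ) :
    IsShortCk ((fun z => translate k R (L z)) ⁻¹' Ω) := by
  have htranslate (w : Fin k → ℂ) : translate k R w = w + translate k R 0 := by
    ext i
    simp [translate]
  simpa only [← htranslate] using h.preimage_affine L (translate k R 0)

end Main

end ShortCk

theorem proposition4p1_general {k : ℕ} (hk : 2 ≤ k) {V : Set (Fin k → ℂ)}
    (hV : 2 ≤ (MvPolynomial.vanishingIdeal ℂ V).height) :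
    (∃ Ω : Set (Fin k → ℂ), ShortCk.IsShortCk Ω ∧ Disjoint Ω V) ∧
    ∃ L : (Fin k → ℂ) ≃ₗ[ℂ] (Fin k → ℂ),
      ∀ (d : ℕ) (a : ℝ) (η : ℕ → ℂ) (R : ℝ), 2 ≤ d → 0 < a → a < 1 →
        (∀ n, η n ≠ 0 ∧ ‖η n‖ ≤ a ^ d ^ n) → 1 + a ≤ R →
        Set.MapsTo (fun z => ShortCk.translate k R (L z)) V (ShortCk.Vplus k R) ∧
        ShortCk.IsShortCk ((fun z => ShortCk.translate k R (L z)) ⁻¹'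
          ShortCk.basin (fun n => ShortCk.shiftMap k d (η n))) ∧
        Disjoint ((fun z => ShortCk.translate k R (L z)) ⁻¹'
          ShortCk.basin (fun n => ShortCk.shiftMap k d (η n))) V := by
  obtain ⟨n, rfl⟩ : ∃ n, k = n + 2 := ⟨k - 2, by lia⟩
  obtain ⟨L, hL⟩ := ShortCk.exists_linearEquiv_mapsTo_Vplus hV
  refine (and_iff_right_of_imp ?_).mpr ⟨L, fun d a η R hd ha ha1 hη hR => ?_⟩
  · rintro ⟨L, hL⟩
    obtain ⟨-, hshort, hdisj⟩ := hL 2 (1 / 2) (fun m => (1 / 2) ^ 2 ^ m) 2 le_rfl (by norm_num)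
      (by norm_num) (fun m => ⟨pow_ne_zero _ (by norm_num), by simp⟩) (by norm_num)
    exact ⟨_, hshort, hdisj⟩
  · have hV' := hL R (by linarith)
    have hηa (m : ℕ) : ‖η m‖ ≤ a :=
      (hη m).2.trans (pow_le_of_le_one ha.le ha1.le (pow_pos (by lia) m).ne')
    have hbasin := ShortCk.disjoint_basin_shiftMap_Vplus (k := n + 2) hd
      (fun m => (hηa m).trans ha1.le) (fun m => (add_le_add_right (hηa m) 1).trans hR)
    exact ⟨hV', (ShortCk.isShortCk_basin_shiftMap hd ha ha1 (fun m => (hη m).1)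
      fun m => (hη m).2).preimage_translate L R,
      (hbasin.preimage _).mono_right hV'⟩

theorem proposition4p1 (k : ℕ) (hk : 3 ≤ k) (V : Set (Fin k → ℂ))
    (hV : ShortCk.IsAlgebraicOfCodim V 2) :
    (∃ Ω : Set (Fin k → ℂ), ShortCk.IsShortCk Ω ∧ Disjoint Ω V) ∧
    ∀ (d : ℕ) (a : ℝ) (η : ℕ → ℂ) (R : ℝ), 2 ≤ d → 0 < a → a < 1 →
      (∀ n, η n ≠ 0 ∧ ‖η n‖ ≤ a ^ d ^ n) → 1 + a < R →
      ∃ L : (Fin k → ℂ) ≃ₗ[ℂ] (Fin k → ℂ),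
        Set.MapsTo (fun z => ShortCk.translate k R (L z)) V (ShortCk.Vplus k R) ∧
        ShortCk.IsShortCk ((fun z => ShortCk.translate k R (L z)) ⁻¹'
          ShortCk.basin (fun n => ShortCk.shiftMap k d (η n))) ∧
        Disjoint ((fun z => ShortCk.translate k R (L z)) ⁻¹'
          ShortCk.basin (fun n => ShortCk.shiftMap k d (η n))) V := by
  obtain ⟨hΩ, L, hL⟩ := proposition4p1_general (by lia) hV.2.ge
  exact ⟨hΩ, fun d a η R hd ha ha1 hη hR => ⟨L, hL d a η R hd ha ha1 hη hR.le⟩⟩
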